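/- A Jordan curve is the image of a circle under a continuous injective map into the plane $\mathbb{R}^2$. The stabbing number $\mathrm{stab}(J)$ of a Jordan curve $J$ is the supremum of $|J\cap \ell|$ over all lines $\ell$ for which $J\cap\ell$ is countable. A finite set of points is in general position if no three of its points are collinear. The degree $d(X)$ of a finite set $X\subset\mathbb{R}^2$ is the smallest $d$ such that there is a Jordan curve $J\supseteq X$ with $\mathrm{stab}(J)\le d$. **Lemma 4.3.** There is an absolute constant $C>0$ such that every nonempty set $X\subset\mathbb{R}^2$ of $N$ points in general position satisfies $d(X)\le C\sqrt N$. Indeed, there is a Jordan curve through all points of $X$ that meets every line of the plane, without exception, in at most $C\sqrt N$ points. -/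

import Mathlib

open scoped Affine

/-- The Euclidean plane. -/
abbrev Plane : Type := EuclideanSpace ℝ (Fin 2)

/-- A finite set of points is in general position if no three distinct points of it are collinear. -/
def InGeneralPosition (X : Finset Plane) : Prop :=
  ∀ a ∈ X, ∀ b ∈ X, ∀ c ∈ X, a ≠ b → a ≠ c → b ≠ c → ¬ Collinear ℝ {a, b, c}

/-- A Jordan curve: a simple closed curve in the plane, i.e. the image of the circle under a
continuous injective map. -/
def IsJordanCurve (J : Set Plane) : Prop :=
  ∃ γ : Circle → Plane, Continuous γ ∧ Function.Injective γ ∧ Set.range γ = J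

/-- The stabbing number of a planar set: the supremum (in `ℕ∞`) of the number of points in which
it meets a line, over all lines that meet it in a countable set. (Every line of the plane is
`line[ℝ, p, q]` for some two distinct points `p`, `q`.) -/
noncomputable def stab (J : Set Plane) : ℕ∞ :=
  ⨆ (p : Plane) (q : Plane) (_ : p ≠ q)
    (_ : (J ∩ (line[ℝ, p, q] : Set Plane)).Countable),
      (J ∩ (line[ℝ, p, q] : Set Plane)).encard

/-- A `d`-curve is a Jordan curve with stabbing number at most `d`. -/
def IsDCurve (d : ℕ∞) (J : Set Plane) : Prop :=
  IsJordanCurve J ∧ stab J ≤ d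

/-- The degree of a point set `X`: the smallest `d` such that some `d`-curve passes through all
points of `X`. -/
noncomputable def degree (X : Finset Plane) : ℕ∞ :=
  sInf {d : ℕ∞ | ∃ J : Set Plane, IsDCurve d J ∧ (X : Set Plane) ⊆ J}

/-! The proof combines Welzl's theorem on spanning paths with low crossing number with an uncrossing
argument, and finally bends the edges of a polygon.

**Few crossings.** Given `k` points and `M` lines in the plane, some two of the points are separated
by only `O(1 + M / √k)` lines (`exists_numSeparating_le`). After a perturbation
(`exists_perturbation`) no three lines are concurrent, and then each point `x` has `r ^ 2` ordered
pairs of lines whose intersection point is separated from `x` by at most `2 * r` lines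
(`sq_le_card_inter_near`). If `k * r ^ 2 > M ^ 2`, two points share such a pair. Only the finitely
many dichotomies of the point set `X` by lines matter; by Sauer–Shelah and Radon there are
polynomially many (`card_dichotomies_le`). Starting from `n` one-point paths and always joining two
paths by an edge that is light with respect to the weights `2 ^ (number of crossings so far)`, the
total weight stays below `n ^ O(1) * exp (O(√n))`
(`exists_join_paths`), hence each line crosses the final path `O(√n)` times
(`exists_path_crossing_le`).

**A simple polygon.** Replacing two intersecting edges `a b`, `c d` of a closed polygon by
`a c`, `b d` decreases its length and does not increase its number of crossings with any line. So the shortest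
Hamiltonian cycle with few crossings is a simple polygon (`exists_simple_polygon`).

**Bending.** Lines may contain edges of the polygon, so the edges are replaced by parabolic arcs of
small height `ε`, each of which meets every line at most twice (`encard_arc_inter_le_two`). For
small `ε` the arcs still form a Jordan curve, and a line meeting an arc without separating its
endpoints is so close to one of them (`near_or_near_of_arc`) that, by general position, only two
vertices and thus at most four arcs are concerned. -/

open Filter Topology

/-! ### The cost of a path -/

/-- The total cost of a path, given as the list of its vertices: the sum of `w a b` over all pairs
of consecutive vertices `a`, `b`. -/
def pathCost {α M : Type*} [AddCommMonoid M] (w : α → α → M) : List α → M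
  | [] => 0
  | [_] => 0
  | a :: b :: l => w a b + pathCost w (b :: l)

section PathCost

variable {α M : Type*} [AddCommMonoid M] (w : α → α → M)

@[simp] lemma pathCost_nil : pathCost w [] = 0 := rfl

@[simp] lemma pathCost_singleton (a : α) : pathCost w [a] = 0 := rfl

@[simp] lemma pathCost_cons_cons (a b : α) (l : List α) :
    pathCost w (a :: b :: l) = w a b + pathCost w (b :: l) := rfl

lemma pathCost_append : ∀ (l₁ l₂ : List α) (h₁ : l₁ ≠ []) (h₂ : l₂ ≠ []),
    pathCost w (l₁ ++ l₂) =
      pathCost w l₁ + w (l₁.getLast h₁) (l₂.head h₂) + pathCost w l₂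
  | [], _, h₁, _ => absurd rfl h₁
  | [a], b :: l₂, _, _ => by simp
  | a :: b :: l, l₂, _, h₂ => by
      have := pathCost_append (b :: l) l₂ (by simp) h₂
      simp only [List.cons_append, pathCost_cons_cons] at this ⊢
      rw [this, List.getLast_cons (List.cons_ne_nil b l)]
      simp only [add_assoc]

lemma pathCost_reverse (hw : ∀ a b, w a b = w b a) :
    ∀ l : List α, pathCost w l.reverse = pathCost w l
  | [] => rfl
  | [a] => rfl
  | a :: b :: l => by
      have := pathCost_reverse hw (b :: l)
      rw [List.reverse_cons, pathCost_append w _ _ (by simp) (by simp), this]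
      simp [hw a b, add_comm]

lemma pathCost_eq_sum (d : α) : ∀ (l : List α),
    pathCost w l = ∑ i ∈ Finset.range (l.length - 1), w (l.getD i d) (l.getD (i + 1) d)
  | [] => by simp
  | [a] => by simp
  | a :: b :: l => by
      have := pathCost_eq_sum d (b :: l)
      rw [pathCost_cons_cons, this]
      simp only [List.length_cons, Nat.add_sub_cancel]
      rw [Finset.sum_range_succ']
      simp only [List.getD_cons_succ, List.getD_cons_zero]
      exact add_comm _ _

/-- Reversing a middle section of a path only affects the two edges at the ends of the section. -/
lemma pathCost_reverse_middle (hw : ∀ a b, w a b = w b a) (l₁ l₂ l₃ : List α)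
    (h₁ : l₁ ≠ []) (h₂ : l₂ ≠ []) (h₃ : l₃ ≠ []) :
    ∃ m : M,
      pathCost w (l₁ ++ l₂ ++ l₃) =
        m + (w (l₁.getLast h₁) (l₂.head h₂) + w (l₂.getLast h₂) (l₃.head h₃)) ∧
      pathCost w (l₁ ++ l₂.reverse ++ l₃) =
        m + (w (l₁.getLast h₁) (l₂.getLast h₂) + w (l₂.head h₂) (l₃.head h₃)) := by
  refine ⟨pathCost w l₁ + pathCost w l₂ + pathCost w l₃, ?_, ?_⟩
  · rw [pathCost_append w (l₁ ++ l₂) l₃ (by simp [h₁]) h₃, pathCost_append w l₁ l₂ h₁ h₂,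
      List.getLast_append_of_right_ne_nil _ _ h₂]
    abel
  · rw [pathCost_append w (l₁ ++ l₂.reverse) l₃ (by simp [h₁]) h₃,
      pathCost_append w l₁ l₂.reverse h₁ (by simp [h₂]),
      List.getLast_append_of_right_ne_nil _ _ (by simp [h₂]), pathCost_reverse w hw,
      List.getLast_reverse, List.head_reverse]
    abel

end PathCost

/-! ### Affine functions and families of lines in general position -/

/-- The value at the point `p` of the affine function with coefficients `g`. For `(g 0, g 1) ≠ 0`
its zero set is a line, and every line of the plane is of this form. -/
def affineEval (g : Fin 3 → ℝ) (p : Plane) : ℝ := g 0 * p 0 + g 1 * p 1 + g 2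

lemma affineEval_add_smul (g h : Fin 3 → ℝ) (t : ℝ) (p : Plane) :
    affineEval (g + t • h) p = affineEval g p + t * affineEval h p := by
  simp only [affineEval, Pi.add_apply, Pi.smul_apply, smul_eq_mul]
  ring

lemma affineEval_lineMap (g : Fin 3 → ℝ) (p q : Plane) (t : ℝ) :
    affineEval g (AffineMap.lineMap p q t) = (1 - t) * affineEval g p + t * affineEval g q := by
  simp only [affineEval, AffineMap.lineMap_apply, vsub_eq_sub, vadd_eq_add, PiLp.add_apply,
    PiLp.smul_apply, PiLp.sub_apply, smul_eq_mul]
  ring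

/-- A cubic polynomial function with nonzero leading coefficient has no zeros in some punctured
right neighbourhood of the origin. -/
lemma eventually_cubic_ne_zero (a b c d : ℝ) (hd : d ≠ 0) :
    ∀ᶠ t in 𝓝[>] (0 : ℝ), a + b * t + c * t ^ 2 + d * t ^ 3 ≠ 0 := by
  set P : Polynomial ℝ := Polynomial.C a + Polynomial.C b * Polynomial.X +
    Polynomial.C c * Polynomial.X ^ 2 + Polynomial.C d * Polynomial.X ^ 3 with hP
  have hP0 : P ≠ 0 := by
    intro h
    have : P.coeff 3 = d := by
      simp [hP, Polynomial.coeff_X_pow]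
    rw [h] at this
    exact hd (by simpa using this.symm)
  have hfin : {t | P.IsRoot t}.Finite := Polynomial.finite_setOfPred_isRoot hP0
  have h1 : ∀ᶠ t in 𝓝[≠] (0 : ℝ), t ∉ {t | P.IsRoot t} := by
    have := (hfin.subset (Set.sdiff_subset (t := {0}))).isClosed.isOpen_compl.mem_nhds
      (show (0 : ℝ) ∈ ({t | P.IsRoot t} \ {0})ᶜ by simp)
    filter_upwards [nhdsWithin_le_nhds this, self_mem_nhdsWithin] with t ht ht0 h
    exact ht ⟨h, ht0⟩
  have h2 := h1.filter_mono (nhdsWithin_mono (0 : ℝ) (fun t (ht : 0 < t) => ht.ne'))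
  filter_upwards [h2] with t ht h0
  apply ht
  simpa [hP, Polynomial.IsRoot] using h0

/-- A finite family of lines, given by affine functions that do not vanish on a finite set `X`, can
be moved so that no three of them are concurrent and none is horizontal, without changing the
signs on `X`. Moving the coefficient vectors along distinct points `(1, s, s²)` of a conic works,
since the relevant determinants become nonzero polynomials in the time of the motion. -/
lemma exists_perturbation {ι : Type*} [Finite ι] (X : Finset Plane) (g : ι → Fin 3 → ℝ)
    (hg : ∀ i, ∀ x ∈ X, affineEval (g i) x ≠ 0) :
    ∃ g' : ι → Fin 3 → ℝ, (∀ i, ∀ x ∈ X, 0 < affineEval (g i) x * affineEval (g' i) x) ∧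
      (∀ i, g' i 0 ≠ 0) ∧
      ∀ i j k, i ≠ j → i ≠ k → j ≠ k → ∀ z,
        ¬ (affineEval (g' i) z = 0 ∧ affineEval (g' j) z = 0 ∧ affineEval (g' k) z = 0) := by
  obtain ⟨n, ⟨e⟩⟩ := Finite.exists_equiv_fin ι
  set s : ι → ℝ := fun i => ((e i : ℕ) : ℝ) with hs
  have hsinj : ∀ i j, i ≠ j → s j - s i ≠ 0 := by
    intro i j hij h
    apply hij
    apply e.injective
    apply Fin.ext
    have : ((e i : ℕ) : ℝ) = (e j : ℕ) := by simp only [hs] at h; linarith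
    exact_mod_cast this
  set G : ℝ → ι → Fin 3 → ℝ := fun t i => g i + t • ![1, s i, s i ^ 2] with hG
  have key : ∀ᶠ t in 𝓝[>] (0 : ℝ), (∀ i, ∀ x ∈ X, 0 < affineEval (g i) x * affineEval (G t i) x) ∧
      (∀ i, G t i 0 ≠ 0) ∧
      ∀ i j k, i ≠ j → i ≠ k → j ≠ k → ∀ z,
        ¬ (affineEval (G t i) z = 0 ∧ affineEval (G t j) z = 0 ∧ affineEval (G t k) z = 0) := by
    refine Eventually.and ?_ (Eventually.and ?_ ?_)
    · rw [eventually_all]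
      intro i
      rw [Finset.eventually_all]
      intro x hx
      have hc : Continuous fun t : ℝ => affineEval (g i) x * affineEval (G t i) x := by
        simp only [hG, affineEval_add_smul]
        fun_prop
      have h0 : 0 < affineEval (g i) x * affineEval (G 0 i) x := by
        simp only [hG, affineEval_add_smul, zero_mul, add_zero]
        exact mul_self_pos.2 (hg i x hx)
      exact nhdsWithin_le_nhds ((hc.tendsto 0).eventually_const_lt h0)
    · rw [eventually_all]
      intro i
      by_cases h : g i 0 = 0
      · filter_upwards [self_mem_nhdsWithin] with t (ht : 0 < t)
        have : G t i 0 = t := by simp only [hG, Pi.add_apply, Pi.smul_apply, h]; simp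
        rw [this]
        exact ht.ne'
      · have hc : Continuous fun t : ℝ => G t i 0 := by
          simp only [hG, Pi.add_apply, Pi.smul_apply]
          fun_prop
        exact nhdsWithin_le_nhds ((hc.tendsto 0).eventually_ne (by
          simp only [hG, zero_smul, add_zero]
          exact h))
    · simp only [eventually_all]
      intro i j k hij hik hjk
      have hd : (s j - s i) * (s k - s i) * (s k - s j) ≠ 0 :=
        mul_ne_zero (mul_ne_zero (hsinj _ _ hij) (hsinj _ _ hik)) (hsinj _ _ hjk)
      -- The determinant of three rows `u + t • (1, s, s²)`, expanded in powers of `t`.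
      set D : (Fin 3 → ℝ) → (Fin 3 → ℝ) → (Fin 3 → ℝ) → ℝ := fun u v w =>
        u 0 * (v 1 * w 2 - v 2 * w 1) - u 1 * (v 0 * w 2 - v 2 * w 0) +
          u 2 * (v 0 * w 1 - v 1 * w 0) with hD
      set v : ι → Fin 3 → ℝ := fun i => ![1, s i, s i ^ 2] with hv
      have hdet : ∀ t, D (G t i) (G t j) (G t k) = D (g i) (g j) (g k) +
          (D (v i) (g j) (g k) + D (g i) (v j) (g k) + D (g i) (g j) (v k)) * t +
          (D (g i) (v j) (v k) + D (v i) (g j) (v k) + D (v i) (v j) (g k)) * t ^ 2 +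
          D (v i) (v j) (v k) * t ^ 3 := by
        intro t
        simp only [hD, hG, Pi.add_apply, Pi.smul_apply, smul_eq_mul, hv]
        ring
      have hlead : D (v i) (v j) (v k) = (s j - s i) * (s k - s i) * (s k - s j) := by
        simp [hD, hv]
        ring
      filter_upwards [eventually_cubic_ne_zero _ _ _ _ (hlead ▸ hd)] with t ht z hz
      apply ht
      rw [← hdet]
      obtain ⟨h1, h2, h3⟩ := hz
      simp only [affineEval] at h1 h2 h3
      generalize G t i = u at *
      generalize G t j = v' at *
      generalize G t k = w at *
      simp only [hD]
      linear_combination (v' 0 * w 1 - v' 1 * w 0) * h1 - (u 0 * w 1 - u 1 * w 0) * h2 +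
        (u 0 * v' 1 - u 1 * v' 0) * h3
  obtain ⟨t, ht⟩ := key.exists
  exact ⟨G t, ht⟩

/-- In a finite family of at least `r` elements, at least `r` elements have fewer than `r` elements
strictly below them. -/
lemma card_le_card_filter_rank_lt {ι : Type*} [Fintype ι] (key : ι → ℝ) (r : ℕ)
    (hr : r ≤ Fintype.card ι) :
    r ≤ (Finset.univ.filter fun i =>
      (Finset.univ.filter fun j => key j < key i).card < r).card := by
  classical
  by_cases h : ∃ i, r ≤ (Finset.univ.filter fun j => key j < key i).card
  · obtain ⟨i, hi, hmin⟩ := Finset.exists_min_image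
      (Finset.univ.filter fun i => r ≤ (Finset.univ.filter fun j => key j < key i).card) key
      (by obtain ⟨i, hi⟩ := h; exact ⟨i, by simpa using hi⟩)
    refine le_trans (by simpa using hi) (Finset.card_le_card ?_)
    intro j hj
    simp only [Finset.mem_filter, Finset.mem_univ, true_and] at hj hmin ⊢
    by_contra hcon
    exact absurd (hmin j (not_lt.1 hcon)) (not_le.2 hj)
  · push Not at h
    rw [Finset.filter_true_of_mem (fun i _ => h i)]
    simpa using hr

/-! ### Two points separated by few lines -/

/-- The orthogonal projection of `x` to the line `affineEval g = 0`. -/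
noncomputable def lineFoot (g : Fin 3 → ℝ) (x : Plane) : Plane :=
  !₂[x 0 - g 0 * affineEval g x / (g 0 ^ 2 + g 1 ^ 2),
    x 1 - g 1 * affineEval g x / (g 0 ^ 2 + g 1 ^ 2)]

/-- The intersection point of the lines `affineEval g = 0` and `affineEval h = 0`, by Cramer's rule;
if they are parallel or equal, an arbitrary point of the first line. -/
noncomputable def lineInter (g h : Fin 3 → ℝ) : Plane :=
  if g 0 * h 1 - g 1 * h 0 = 0 then lineFoot g 0
  else !₂[(g 1 * h 2 - g 2 * h 1) / (g 0 * h 1 - g 1 * h 0),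
    (g 2 * h 0 - g 0 * h 2) / (g 0 * h 1 - g 1 * h 0)]

lemma affineEval_lineFoot {g : Fin 3 → ℝ} (hg : g 0 ≠ 0) (x : Plane) :
    affineEval g (lineFoot g x) = 0 := by
  have : g 0 ^ 2 + g 1 ^ 2 ≠ 0 := by positivity
  simp only [affineEval, lineFoot, Matrix.cons_val_zero, Matrix.cons_val_one]
  field_simp
  ring

lemma affineEval_lineInter {g : Fin 3 → ℝ} (hg : g 0 ≠ 0) (h : Fin 3 → ℝ) :
    affineEval g (lineInter g h) = 0 := by
  unfold lineInter
  split_ifs with he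
  · exact affineEval_lineFoot hg 0
  · simp only [affineEval, Matrix.cons_val_zero, Matrix.cons_val_one]
    generalize hE : g 0 * h 1 - g 1 * h 0 = e at *
    field_simp
    rw [← hE]
    ring

/-- A line separating `x` from its projection to a second line is closer to `x` than the second
line. -/
lemma dist_sq_lt_of_separates_lineFoot {g h : Fin 3 → ℝ} (hg : g 0 ≠ 0) (hh : h 0 ≠ 0) {x : Plane}
    (hx : affineEval h x * affineEval h (lineFoot g x) < 0) :
    affineEval h x ^ 2 / (h 0 ^ 2 + h 1 ^ 2) < affineEval g x ^ 2 / (g 0 ^ 2 + g 1 ^ 2) := by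
  have hG : 0 < g 0 ^ 2 + g 1 ^ 2 := by positivity
  have hH : 0 < h 0 ^ 2 + h 1 ^ 2 := by positivity
  set τ := affineEval g x / (g 0 ^ 2 + g 1 ^ 2) with hτ
  have h1 : affineEval h (lineFoot g x) = affineEval h x - τ * (g 0 * h 0 + g 1 * h 1) := by
    simp only [affineEval, lineFoot, PiLp.toLp_apply, Matrix.cons_val_zero, Matrix.cons_val_one,
      hτ]
    ring
  have h2 : affineEval g x ^ 2 / (g 0 ^ 2 + g 1 ^ 2) = τ ^ 2 * (g 0 ^ 2 + g 1 ^ 2) := by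
    rw [hτ]
    field_simp
  rw [h2, div_lt_iff₀ hH]
  rw [h1] at hx
  set a := affineEval h x
  set d := g 0 * h 0 + g 1 * h 1 with hd
  have h3 : a ^ 2 < (τ * d) ^ 2 := by nlinarith [sq_nonneg (a - τ * d)]
  have h4 : d ^ 2 ≤ (g 0 ^ 2 + g 1 ^ 2) * (h 0 ^ 2 + h 1 ^ 2) := by
    rw [hd]
    nlinarith [sq_nonneg (g 0 * h 1 - g 1 * h 0)]
  calc a ^ 2 < τ ^ 2 * d ^ 2 := by rw [← mul_pow]; exact h3
    _ ≤ τ ^ 2 * ((g 0 ^ 2 + g 1 ^ 2) * (h 0 ^ 2 + h 1 ^ 2)) := by gcongr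
    _ = _ := by ring

/-- A line separating two points `y`, `z` of a second line meets it between them, hence closer to
`y` than `z`. -/
lemma dist_lineInter_lt_of_separates {g h : Fin 3 → ℝ} (hg : g 0 ≠ 0) {y z : Plane}
    (hy : affineEval g y = 0) (hz : affineEval g z = 0)
    (hyz : affineEval h y * affineEval h z < 0) :
    dist y (lineInter g h) < dist y z := by
  have hne : affineEval h y - affineEval h z ≠ 0 := by
    intro h0
    rw [sub_eq_zero.1 h0] at hyz
    exact absurd hyz (not_lt.2 (mul_self_nonneg _))
  have he : g 0 * h 1 - g 1 * h 0 ≠ 0 := by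
    intro he
    have : g 0 * (affineEval h y - affineEval h z) = 0 := by
      simp only [affineEval] at hy hz ⊢
      linear_combination h 0 * hy - h 0 * hz + (y 1 - z 1) * he
    exact (mul_ne_zero hg hne) this
  set θ := affineEval h y / (affineEval h y - affineEval h z) with hθ
  set w : Plane := AffineMap.lineMap y z θ with hw
  have hgw : affineEval g w = 0 := by rw [hw, affineEval_lineMap, hy, hz]; ring
  have hhw : affineEval h w = 0 := by
    rw [hw, affineEval_lineMap, hθ]
    field_simp
    ring
  have hwi : lineInter g h = w := by
    unfold lineInter
    rw [if_neg he]
    simp only [affineEval] at hgw hhw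
    ext i
    fin_cases i
    · simp only [Fin.zero_eta, Matrix.cons_val_zero]
      rw [div_eq_iff he]
      linear_combination g 1 * hhw - h 1 * hgw
    · simp only [Fin.mk_one, Matrix.cons_val_one, Matrix.cons_val_zero]
      rw [div_eq_iff he]
      linear_combination h 0 * hgw - g 0 * hhw
  have hθ1 : |θ| < 1 := by
    rw [hθ, abs_div, div_lt_one (abs_pos.2 hne)]
    rw [← sq_lt_sq]
    nlinarith [sq_nonneg (affineEval h z), mul_self_nonneg (affineEval h z)]
  have hne' : y ≠ z := by
    rintro rfl
    exact absurd hyz (not_lt.2 (mul_self_nonneg _))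
  rw [hwi, hw, dist_left_lineMap, Real.norm_eq_abs]
  exact mul_lt_of_lt_one_left (dist_pos.2 hne') hθ1

/-- At most two lines of a family without three concurrent lines pass through a given point. -/
lemma card_lines_through_le_two {ι : Type*} [Fintype ι] (g : ι → Fin 3 → ℝ)
    (hconc : ∀ i j k, i ≠ j → i ≠ k → j ≠ k → ∀ z,
      ¬ (affineEval (g i) z = 0 ∧ affineEval (g j) z = 0 ∧ affineEval (g k) z = 0)) (z : Plane) :
    (Finset.univ.filter fun l => affineEval (g l) z = 0).card ≤ 2 := by
  classical
  by_contra hcon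
  obtain ⟨i, j, k, hi, hj, hk, hij, hik, hjk⟩ := Finset.two_lt_card_iff.1 (not_le.1 hcon)
  simp only [Finset.mem_filter, Finset.mem_univ, true_and] at hi hj hk
  exact hconc i j k hij hik hjk z ⟨hi, hj, hk⟩

/-- The number of lines of a family that strictly separate two points. -/
noncomputable def numSeparating {ι : Type*} [Fintype ι] (g : ι → Fin 3 → ℝ) (x y : Plane) : ℕ :=
  (Finset.univ.filter fun l => affineEval (g l) x * affineEval (g l) y < 0).card

lemma numSeparating_comm {ι : Type*} [Fintype ι] (g : ι → Fin 3 → ℝ) (x y : Plane) :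
    numSeparating g x y = numSeparating g y x := by
  simp only [numSeparating, mul_comm]

/-- If no three lines are concurrent, separation is a pseudometric up to an additive error of `2`,
caused by the lines through the intermediate point. -/
lemma numSeparating_triangle {ι : Type*} [Fintype ι] (g : ι → Fin 3 → ℝ)
    (hconc : ∀ i j k, i ≠ j → i ≠ k → j ≠ k → ∀ z,
      ¬ (affineEval (g i) z = 0 ∧ affineEval (g j) z = 0 ∧ affineEval (g k) z = 0))
    (x y z : Plane) :
    numSeparating g x z ≤ numSeparating g x y + numSeparating g y z + 2 := by
  classical
  refine le_trans (Finset.card_le_card ?_) (le_trans (Finset.card_union_le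
    ((Finset.univ.filter fun l => affineEval (g l) x * affineEval (g l) y < 0) ∪
      (Finset.univ.filter fun l => affineEval (g l) y * affineEval (g l) z < 0))
    (Finset.univ.filter fun l => affineEval (g l) y = 0)) (Nat.add_le_add
      (Finset.card_union_le _ _) (card_lines_through_le_two g hconc y)))
  intro l
  simp only [Finset.mem_filter, Finset.mem_univ, true_and, Finset.mem_union]
  intro hl
  rcases lt_trichotomy (affineEval (g l) y) 0 with h | h | h
  · rcases mul_neg_iff.1 hl with ⟨h1, -⟩ | ⟨-, h1⟩
    · exact Or.inl (Or.inl (mul_neg_of_pos_of_neg h1 h))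
    · exact Or.inl (Or.inr (mul_neg_of_neg_of_pos h h1))
  · exact Or.inr h
  · rcases mul_neg_iff.1 hl with ⟨-, h1⟩ | ⟨h1, -⟩
    · exact Or.inl (Or.inr (mul_neg_of_pos_of_neg h h1))
    · exact Or.inl (Or.inl (mul_neg_of_neg_of_pos h1 h))

/-- Around every point `x` there are at least `r ^ 2` ordered pairs of lines whose intersection
point is separated from `x` by at most `2 * r` lines: take the `r` lines closest to `x`, and on each
of them the `r` intersection points closest to the projection of `x`. -/
lemma sq_le_card_inter_near {ι : Type*} [Fintype ι] (g : ι → Fin 3 → ℝ) (hg : ∀ i, g i 0 ≠ 0)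
    (hconc : ∀ i j k, i ≠ j → i ≠ k → j ≠ k → ∀ z,
      ¬ (affineEval (g i) z = 0 ∧ affineEval (g j) z = 0 ∧ affineEval (g k) z = 0))
    (x : Plane) (r : ℕ) (hr : r ≤ Fintype.card ι) :
    r * r ≤ (Finset.univ.filter fun a : ι × ι =>
      numSeparating g x (lineInter (g a.1) (g a.2)) ≤ 2 * r).card := by
  classical
  rcases Nat.eq_zero_or_pos r with rfl | hr0
  · simp
  set K : ι → ℝ := fun i => affineEval (g i) x ^ 2 / (g i 0 ^ 2 + g i 1 ^ 2) with hK
  set K' : ι → ι → ℝ := fun i j => dist (lineFoot (g i) x) (lineInter (g i) (g j)) with hK'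
  set A := Finset.univ.filter fun i => (Finset.univ.filter fun j => K j < K i).card < r with hA
  set B : ι → Finset ι := fun i => Finset.univ.filter fun j =>
    (Finset.univ.filter fun l => K' i l < K' i j).card < r with hB
  have hAc : r ≤ A.card := card_le_card_filter_rank_lt K r hr
  have hBc : ∀ i, r ≤ (B i).card := fun i => card_le_card_filter_rank_lt (K' i) r hr
  calc r * r ≤ A.card * r := Nat.mul_le_mul_right r hAc
    _ ≤ ∑ i ∈ A, (B i).card := by
        rw [← smul_eq_mul]
        exact Finset.card_nsmul_le_sum A _ r (fun i _ => hBc i)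
    _ = (A.sigma B).card := (Finset.card_sigma A B).symm
    _ ≤ _ := by
        refine Finset.card_le_card_of_injOn (fun a => (a.1, a.2)) ?_ ?_
        · rintro ⟨i, j⟩ hij
          simp only [Finset.coe_sigma, Set.mem_sigma_iff, Finset.mem_coe, hA, hB,
            Finset.mem_filter, Finset.mem_univ, true_and] at hij
          obtain ⟨h1, h2⟩ := hij
          simp only [Finset.coe_filter, Finset.mem_univ, true_and, Set.mem_ofPred_eq]
          have t := numSeparating_triangle g hconc x (lineFoot (g i) x) (lineInter (g i) (g j))
          have t1 : numSeparating g x (lineFoot (g i) x) < r :=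
            lt_of_le_of_lt (Finset.card_le_card fun l hl => by
              simp only [Finset.mem_filter, Finset.mem_univ, true_and] at hl ⊢
              exact dist_sq_lt_of_separates_lineFoot (hg i) (hg l) hl) h1
          have t2 : numSeparating g (lineFoot (g i) x) (lineInter (g i) (g j)) < r :=
            lt_of_le_of_lt (Finset.card_le_card fun l hl => by
              simp only [Finset.mem_filter, Finset.mem_univ, true_and] at hl ⊢
              exact dist_lineInter_lt_of_separates (hg i) (affineEval_lineFoot (hg i) x)
                (affineEval_lineInter (hg i) _) hl) h2
          omega
        · rintro ⟨i, j⟩ - ⟨i', j'⟩ - h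
          simp only [Prod.mk.injEq] at h
          obtain ⟨rfl, rfl⟩ := h
          rfl

/-- Among many points, some two are separated by few lines: otherwise the sets of nearby pairs of
lines provided by `sq_le_card_inter_near` would be disjoint, and there are too few pairs. -/
lemma exists_numSeparating_le {ι : Type*} [Fintype ι] (g : ι → Fin 3 → ℝ) (hg : ∀ i, g i 0 ≠ 0)
    (hconc : ∀ i j k, i ≠ j → i ≠ k → j ≠ k → ∀ z,
      ¬ (affineEval (g i) z = 0 ∧ affineEval (g j) z = 0 ∧ affineEval (g k) z = 0))
    (Y : Finset Plane) (hY : 2 ≤ Y.card) (r : ℕ)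
    (hr : Fintype.card ι * Fintype.card ι < Y.card * (r * r)) :
    ∃ x ∈ Y, ∃ y ∈ Y, x ≠ y ∧ numSeparating g x y ≤ 4 * r + 2 := by
  classical
  rcases le_or_gt r (Fintype.card ι) with hrM | hrM
  · set B : Plane → Finset (ι × ι) := fun x => Finset.univ.filter fun a : ι × ι =>
      numSeparating g x (lineInter (g a.1) (g a.2)) ≤ 2 * r with hB
    have hnot : ¬ (Y : Set Plane).PairwiseDisjoint B := by
      intro hdis
      have h1 := Finset.card_biUnion hdis
      have h2 : (Y.biUnion B).card ≤ Fintype.card ι * Fintype.card ι := by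
        rw [← Fintype.card_prod]
        exact Finset.card_le_univ _
      have h3 : Y.card * (r * r) ≤ ∑ x ∈ Y, (B x).card := by
        rw [← smul_eq_mul]
        exact Finset.card_nsmul_le_sum Y _ _
          (fun x _ => sq_le_card_inter_near g hg hconc x r hrM)
      omega
    simp only [Set.PairwiseDisjoint, Set.Pairwise, not_forall, Function.onFun] at hnot
    obtain ⟨x, hx, y, hy, hxy, hd⟩ := hnot
    obtain ⟨a, hax, hay⟩ := Finset.not_disjoint_iff.1 hd
    refine ⟨x, hx, y, hy, hxy, ?_⟩
    simp only [hB, Finset.mem_filter, Finset.mem_univ, true_and] at hax hay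
    rw [numSeparating_comm] at hay
    have := numSeparating_triangle g hconc x (lineInter (g a.1) (g a.2)) y
    omega
  · obtain ⟨x, hx, y, hy, hxy⟩ := Finset.one_lt_card.1 hY
    refine ⟨x, hx, y, hy, hxy, ?_⟩
    have : numSeparating g x y ≤ Fintype.card ι := Finset.card_le_univ _
    omega

/-! ### Dichotomies of a point set by lines -/

open Classical in
/-- The dichotomies of `X` by lines: the subsets of `X` cut out by an open half-plane (or by a
constant affine function). -/
noncomputable def dichotomies (X : Finset Plane) : Finset (Finset Plane) :=
  X.powerset.filter fun S => ∃ g : Fin 3 → ℝ, ∀ x ∈ X, x ∈ S ↔ 0 < affineEval g x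

lemma mem_dichotomies {X S : Finset Plane} : S ∈ dichotomies X ↔
    S ⊆ X ∧ ∃ g : Fin 3 → ℝ, ∀ x ∈ X, x ∈ S ↔ 0 < affineEval g x := by
  simp [dichotomies]

lemma empty_mem_dichotomies (X : Finset Plane) : ∅ ∈ dichotomies X :=
  mem_dichotomies.2 ⟨by simp, 0, by simp [affineEval]⟩

/-- The affine function cutting out a dichotomy can be chosen without zeros on `X`. -/
lemma exists_affineEval_of_mem_dichotomies {X S : Finset Plane} (hS : S ∈ dichotomies X) :
    ∃ g : Fin 3 → ℝ, ∀ x ∈ X, (x ∈ S → 0 < affineEval g x) ∧ (x ∉ S → affineEval g x < 0) := by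
  obtain ⟨-, g, hg⟩ := mem_dichotomies.1 hS
  have h : ∀ᶠ t in 𝓝[>] (0 : ℝ), ∀ x ∈ X, x ∈ S → t < affineEval g x := by
    rw [Finset.eventually_all]
    intro x hx
    by_cases hxS : x ∈ S
    · filter_upwards [nhdsWithin_le_nhds (eventually_lt_nhds ((hg x hx).1 hxS))] with t ht _
      exact ht
    · exact Eventually.of_forall fun t h => absurd h hxS
  obtain ⟨t, ht, ht0⟩ := (h.and self_mem_nhdsWithin).exists
  have hev : ∀ x, affineEval ![g 0, g 1, g 2 - t] x = affineEval g x - t := by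
    intro x
    simp [affineEval]
    ring
  refine ⟨![g 0, g 1, g 2 - t], fun x hx => ⟨fun hxS => ?_, fun hxS => ?_⟩⟩
  · rw [hev]
    exact sub_pos.2 (ht x hx hxS)
  · rw [hev]
    have h1 : affineEval g x ≤ 0 := not_lt.1 fun h => hxS ((hg x hx).2 h)
    have h2 : 0 < t := ht0
    linarith

/-- By the Sauer–Shelah lemma, `n` points have `O(n ^ 3)` dichotomies by lines: by Radon's theorem
no four points are shattered. -/
lemma card_dichotomies_le (X : Finset Plane) : (dichotomies X).card ≤ (X.card + 1) ^ 3 := by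
  classical
  have hsub : (dichotomies X).shatterer ⊆ (Finset.range 4).biUnion fun k => X.powersetCard k := by
    intro s hs
    rw [Finset.mem_shatterer] at hs
    obtain ⟨t, ht, hst⟩ := hs.exists_superset
    have hsX : s ⊆ X := hst.trans (mem_dichotomies.1 ht).1
    simp only [Finset.mem_biUnion, Finset.mem_range, Finset.mem_powersetCard]
    refine ⟨s.card, ?_, hsX, rfl⟩
    by_contra hcard
    have hnot : ¬ AffineIndependent ℝ (fun x : s => (x : Plane)) := by
      intro hind
      have h1 := hind.card_le_finrank_succ
      have h2 : Module.finrank ℝ (vectorSpan ℝ (Set.range fun x : s => (x : Plane))) ≤ 2 := by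
        refine (Submodule.finrank_le _).trans ?_
        simp
      rw [Fintype.card_coe] at h1
      omega
    obtain ⟨I, p, hpI, hpI'⟩ := Convex.radon_partition hnot
    obtain ⟨u, hu, hsu⟩ := hs (t := s.filter fun x => ∃ h : x ∈ s, (⟨x, h⟩ : s) ∈ I)
      (Finset.filter_subset _ _)
    obtain ⟨-, g, hg⟩ := mem_dichotomies.1 hu
    have hmem : ∀ x : s, x ∈ I ↔ 0 < affineEval g x := by
      intro x
      rw [← hg x (hsX x.2)]
      have := congrArg (fun A => (x : Plane) ∈ A) hsu
      simpa using this.symm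
    have hconv : ∀ (A : Set Plane), (∀ x ∈ A, 0 < affineEval g x) →
        ∀ x ∈ convexHull ℝ A, 0 < affineEval g x := by
      intro A hA
      refine convexHull_min (t := {x | 0 < affineEval g x}) hA ?_
      intro x hx y hy a b ha hb hab
      simp only [Set.mem_ofPred_eq, affineEval, PiLp.add_apply, PiLp.smul_apply,
        smul_eq_mul] at hx hy ⊢
      have : a * (g 0 * x 0 + g 1 * x 1 + g 2) + b * (g 0 * y 0 + g 1 * y 1 + g 2) > 0 := by
        rcases ha.eq_or_lt with rfl | ha
        · have : b = 1 := by linarith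
          subst this
          linarith
        · have := mul_pos ha hx
          have := mul_nonneg hb hy.le
          linarith
      have h3 : g 2 = (a + b) * g 2 := by rw [hab, one_mul]
      rw [h3]
      linarith
    have hconv' : ∀ (A : Set Plane), (∀ x ∈ A, affineEval g x ≤ 0) →
        ∀ x ∈ convexHull ℝ A, affineEval g x ≤ 0 := by
      intro A hA
      refine convexHull_min (t := {x | affineEval g x ≤ 0}) hA ?_
      intro x hx y hy a b ha hb hab
      simp only [Set.mem_ofPred_eq, affineEval, PiLp.add_apply, PiLp.smul_apply,
        smul_eq_mul] at hx hy ⊢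
      have := mul_nonpos_of_nonneg_of_nonpos ha hx
      have := mul_nonpos_of_nonneg_of_nonpos hb hy
      have h3 : g 2 = (a + b) * g 2 := by rw [hab, one_mul]
      rw [h3]
      linarith
    have h1 := hconv _ (by
      rintro _ ⟨x, hx, rfl⟩
      exact (hmem x).1 hx) p hpI
    have h2 := hconv' _ (by
      rintro _ ⟨x, hx, rfl⟩
      exact not_lt.1 fun h => hx ((hmem x).2 h)) p hpI'
    exact absurd h1 (not_lt.2 h2)
  calc (dichotomies X).card ≤ (dichotomies X).shatterer.card := Finset.card_le_card_shatterer _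
    _ ≤ ((Finset.range 4).biUnion fun k => X.powersetCard k).card := Finset.card_le_card hsub
    _ ≤ ∑ k ∈ Finset.range 4, (X.powersetCard k).card := Finset.card_biUnion_le
    _ ≤ ∑ k ∈ Finset.range 4, X.card ^ k := by
        refine Finset.sum_le_sum fun k _ => ?_
        rw [Finset.card_powersetCard]
        exact Nat.choose_le_pow _ _
    _ ≤ (X.card + 1) ^ 3 := by
        simp only [Finset.sum_range_succ, Finset.sum_range_zero]
        ring_nf
        nlinarith [Nat.zero_le X.card]

open Classical in
/-- Whether the set `S` contains exactly one of two points, as a number `0` or `1`. -/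
noncomputable def crossing (S : Finset Plane) (x y : Plane) : ℕ :=
  if (x ∈ S ↔ y ∈ S) then 0 else 1

lemma crossing_comm (S : Finset Plane) (x y : Plane) : crossing S x y = crossing S y x := by
  simp only [crossing, iff_comm]

lemma crossing_le_one (S : Finset Plane) (x y : Plane) : crossing S x y ≤ 1 := by
  unfold crossing
  split_ifs <;> simp

/-- For any weights on the dichotomies of `X`, among `k` points of `X` some two are separated by
dichotomies of weight only `O(1 / √k)` times the total weight. -/
lemma exists_crossing_weight_le (X : Finset Plane) (w : Finset Plane → ℕ)
    (hw : 1 ≤ ∑ S ∈ dichotomies X, w S) (Y : Finset Plane) (hYX : Y ⊆ X) (hY : 2 ≤ Y.card) :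
    ∃ x ∈ Y, ∃ y ∈ Y, x ≠ y ∧
      (∑ S ∈ dichotomies X, w S * crossing S x y : ℝ) ≤
        10 / √(Y.card : ℝ) * ∑ S ∈ dichotomies X, (w S : ℝ) := by
  classical
  set k := Y.card with hk
  set W := ∑ S ∈ dichotomies X, w S with hW
  -- Each dichotomy is represented by `k * w S` lines; the factor `k` makes rounding harmless.
  choose! f hf using fun S (hS : S ∈ dichotomies X) => exists_affineEval_of_mem_dichotomies hS
  obtain ⟨g, hgs, hg0, hconc⟩ := exists_perturbation
    (ι := Σ S : dichotomies X, Fin (k * w S)) X (fun a => f a.1) (by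
      intro a x hx
      have := hf a.1 a.1.2 x hx
      by_cases hxS : x ∈ (a.1 : Finset Plane)
      · exact (this.1 hxS).ne'
      · exact (this.2 hxS).ne)
  have hcard : Fintype.card (Σ S : dichotomies X, Fin (k * w S)) = k * W := by
    rw [Fintype.card_sigma]
    simp only [Fintype.card_fin]
    rw [Finset.sum_coe_sort (dichotomies X) (fun S => k * w S), Finset.mul_sum]
  have hsign : ∀ a, ∀ x ∈ X, (x ∈ (a.1 : Finset Plane) → 0 < affineEval (g a) x) ∧
      (x ∉ (a.1 : Finset Plane) → affineEval (g a) x < 0) := by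
    intro a x hx
    have h1 := hf a.1 a.1.2 x hx
    have h2 := hgs a x hx
    refine ⟨fun h => ?_, fun h => ?_⟩
    · exact (pos_iff_pos_of_mul_pos h2).1 (h1.1 h)
    · exact (neg_iff_neg_of_mul_pos h2).1 (h1.2 h)
  have hsep : ∀ x ∈ X, ∀ y ∈ X,
      numSeparating g x y = k * ∑ S ∈ dichotomies X, w S * crossing S x y := by
    intro x hx y hy
    have h1 : ∀ a, (if affineEval (g a) x * affineEval (g a) y < 0 then 1 else 0) =
        crossing a.1 x y := by
      intro a
      have hx' := hsign a x hx
      have hy' := hsign a y hy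
      unfold crossing
      by_cases h : x ∈ (a.1 : Finset Plane) <;> by_cases h' : y ∈ (a.1 : Finset Plane)
      · simp only [h, h', iff_self, if_true]
        rw [if_neg (not_lt.2 (mul_pos (hx'.1 h) (hy'.1 h')).le)]
      · simp only [h, h', iff_false, not_true, if_false]
        rw [if_pos (mul_neg_of_pos_of_neg (hx'.1 h) (hy'.2 h'))]
      · simp only [h, h', iff_true, if_false]
        rw [if_pos (mul_neg_of_neg_of_pos (hx'.2 h) (hy'.1 h'))]
      · simp only [h, h', iff_self, if_true]
        rw [if_neg (not_lt.2 (mul_pos_of_neg_of_neg (hx'.2 h) (hy'.2 h')).le)]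
    rw [numSeparating, Finset.card_filter, Finset.sum_congr rfl (fun a _ => h1 a),
      Fintype.sum_sigma]
    simp only [Finset.sum_const, Finset.card_univ, Fintype.card_fin, smul_eq_mul]
    rw [Finset.sum_coe_sort (dichotomies X) (fun S => k * w S * crossing S x y), Finset.mul_sum]
    simp only [mul_assoc]
  have hk2 : (2 : ℝ) ≤ k := by exact_mod_cast hY
  have hk0 : (0 : ℝ) < k := by linarith
  have hsq : √(k : ℝ) * √(k : ℝ) = k := Real.mul_self_sqrt hk0.le
  have hs0 : 0 < √(k : ℝ) := Real.sqrt_pos.2 hk0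
  have hs1 : 1 ≤ √(k : ℝ) := Real.one_le_sqrt.2 (by linarith)
  have hW1 : (1 : ℝ) ≤ W := by exact_mod_cast hw
  set r := ⌊√(k : ℝ) * W⌋₊ + 1 with hr
  have hr1 : √(k : ℝ) * W < r := by rw [hr]; exact_mod_cast Nat.lt_floor_add_one _
  have hr2 : (r : ℝ) ≤ √(k : ℝ) * W + 1 := by
    rw [hr]
    push_cast
    have := Nat.floor_le (a := √(k : ℝ) * W) (by positivity)
    linarith
  obtain ⟨x, hx, y, hy, hxy, hle⟩ := exists_numSeparating_le g hg0 hconc Y hY r (by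
    rw [hcard]
    have h1 : (√(k : ℝ) * W) * (√(k : ℝ) * W) < r * r :=
      mul_self_lt_mul_self (by positivity) hr1
    have h2 : (k : ℝ) * ((√(k : ℝ) * W) * (√(k : ℝ) * W)) < k * (r * r) :=
      mul_lt_mul_of_pos_left h1 hk0
    have h3 : (k : ℝ) * ((√(k : ℝ) * W) * (√(k : ℝ) * W)) = k * W * (k * W) := by
      linear_combination (k : ℝ) * W * W * hsq
    rw [h3] at h2
    exact_mod_cast h2)
  refine ⟨x, hx, y, hy, hxy, ?_⟩
  rw [hsep x (hYX hx) y (hYX hy)] at hle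
  have hle' : (k : ℝ) * (∑ S ∈ dichotomies X, w S * crossing S x y : ℝ) ≤ 4 * r + 2 := by
    exact_mod_cast hle
  have hWc : (∑ S ∈ dichotomies X, (w S : ℝ)) = W := by rw [hW]; push_cast; rfl
  rw [hWc, div_mul_eq_mul_div, le_div_iff₀ hs0]
  set T := (∑ S ∈ dichotomies X, w S * crossing S x y : ℝ)
  have h4 : √(k : ℝ) * (√(k : ℝ) * T) ≤ √(k : ℝ) * (10 * W) := by
    rw [← mul_assoc, hsq]
    have : (1 : ℝ) ≤ √(k : ℝ) * W := by nlinarith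
    linarith
  have := le_of_mul_le_mul_left h4 hs0
  linarith

/-! ### Spanning paths with low crossing number -/

lemma one_add_div_sqrt_mul_exp_le (k : ℕ) :
    (1 + 10 / √((k + 2 : ℕ) : ℝ)) * Real.exp (20 * √((k + 1 : ℕ) : ℝ)) ≤
      Real.exp (20 * √((k + 2 : ℕ) : ℝ)) := by
  set a := √((k + 1 : ℕ) : ℝ) with ha
  set b := √((k + 2 : ℕ) : ℝ) with hb
  have ha2 : a ^ 2 = k + 1 := by rw [ha, Real.sq_sqrt (by positivity)]; push_cast; rfl
  have hb2 : b ^ 2 = k + 2 := by rw [hb, Real.sq_sqrt (by positivity)]; push_cast; rfl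
  have hb0 : 0 < b := Real.sqrt_pos.2 (by positivity)
  have ha0 : 0 ≤ a := Real.sqrt_nonneg _
  have h : 10 / b + 20 * a ≤ 20 * b := by
    have h1 : 1 / b ≤ 2 * (b - a) := by
      rw [div_le_iff₀ hb0]
      nlinarith [sq_nonneg (b - a)]
    have h2 : 10 / b = 10 * (1 / b) := by ring
    rw [h2]
    linarith
  calc (1 + 10 / b) * Real.exp (20 * a) ≤ Real.exp (10 / b) * Real.exp (20 * a) := by
        gcongr
        rw [add_comm]
        exact Real.add_one_le_exp _
    _ = Real.exp (10 / b + 20 * a) := (Real.exp_add _ _).symm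
    _ ≤ _ := Real.exp_le_exp.2 h

/-- The reweighting argument. A family of disjoint paths with vertices in `X` can be joined to
one path, at the cost of a factor `exp (O (√k))` in the sum of `2 ^ (number of crossings)` over
all dichotomies: repeatedly join two paths by an edge between their first vertices that is crossed
by little weight. -/
lemma exists_join_paths (X : Finset Plane) : ∀ (k : ℕ) (P : List (List Plane)), P.length = k + 1 →
    (∀ l ∈ P, l ≠ []) → P.flatten.Nodup → (∀ x ∈ P.flatten, x ∈ X) →
    ∃ l : List Plane, l.Perm P.flatten ∧
      (∑ S ∈ dichotomies X, (2 : ℝ) ^ pathCost (crossing S) l) ≤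
        Real.exp (20 * √((k + 1 : ℕ) : ℝ)) *
          ∑ S ∈ dichotomies X, (2 : ℝ) ^ (P.map (pathCost (crossing S))).sum := by
  classical
  intro k
  induction k with
  | zero =>
    intro P hP _ _ _
    obtain ⟨l, rfl⟩ := List.length_eq_one_iff.1 hP
    refine ⟨l, by simp, ?_⟩
    simp only [List.map_cons, List.map_nil, List.sum_cons, List.sum_nil, add_zero]
    refine le_mul_of_one_le_left (by positivity) (Real.one_le_exp (by positivity))
  | succ k ih =>
    intro P hP hne hnd hX
    have hnd' := List.nodup_flatten.1 hnd
    set hd : List Plane → Plane := fun l => l.headD 0 with hhd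
    have hmem : ∀ l ∈ P, hd l ∈ l := by
      intro l hl
      cases l with
      | nil => exact absurd rfl (hne _ hl)
      | cons a t => simp [hhd]
    have hnodup : (P.map hd).Nodup := by
      rw [List.Nodup, List.pairwise_map]
      refine hnd'.2.imp_of_mem ?_
      intro l l' hl hl' hdisj heq
      exact hdisj (hmem l hl) (heq ▸ hmem l' hl')
    set Y := (P.map hd).toFinset with hY
    have hYc : Y.card = k + 2 := by
      rw [hY, List.toFinset_card_of_nodup hnodup, List.length_map, hP]
    obtain ⟨x, hx, y, hy, hxy, hle⟩ := exists_crossing_weight_le X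
      (fun S => 2 ^ (P.map (pathCost (crossing S))).sum) (by
        refine le_trans ?_ (Finset.single_le_sum (f := fun S =>
          2 ^ (P.map (pathCost (crossing S))).sum) (fun _ _ => Nat.zero_le _)
          (empty_mem_dichotomies X))
        exact Nat.one_le_two_pow) Y (by
        intro x hx
        simp only [hY, List.mem_toFinset, List.mem_map] at hx
        obtain ⟨l, hl, rfl⟩ := hx
        exact hX _ (List.mem_flatten.2 ⟨l, hl, hmem l hl⟩)) (by omega)
    simp only [hY, List.mem_toFinset, List.mem_map] at hx hy
    obtain ⟨l₁, hl₁, rfl⟩ := hx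
    obtain ⟨l₂, hl₂, rfl⟩ := hy
    have hl : l₂ ≠ l₁ := fun h => hxy (by rw [h])
    set P' := (P.erase l₁).erase l₂ with hP'
    have hperm : P.Perm (l₁ :: l₂ :: P') :=
      (List.perm_cons_erase hl₁).trans
        ((List.perm_cons_erase ((List.mem_erase_of_ne hl).2 hl₂)).cons l₁)
    have hflat : ((l₁.reverse ++ l₂) :: P').flatten.Perm P.flatten := by
      refine List.Perm.trans ?_ hperm.flatten.symm
      simp only [List.flatten_cons, List.append_assoc]
      exact l₁.reverse_perm.append_right _
    obtain ⟨l, hlp, hlc⟩ := ih ((l₁.reverse ++ l₂) :: P') (by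
        have := hperm.length_eq
        simp only [List.length_cons] at this ⊢
        omega) (by
        intro l hl
        rcases List.mem_cons.1 hl with rfl | hl
        · simp [hne l₁ hl₁]
        · exact hne l (List.mem_of_mem_erase (List.mem_of_mem_erase hl)))
        (hflat.nodup_iff.2 hnd) (fun x hx => hX x (hflat.mem_iff.1 hx))
    refine ⟨l, hlp.trans hflat, hlc.trans ?_⟩
    have hcost : ∀ S, (((l₁.reverse ++ l₂) :: P').map (pathCost (crossing S))).sum =
        (P.map (pathCost (crossing S))).sum + crossing S (hd l₁) (hd l₂) := by
      intro S
      have h1 := (hperm.map (pathCost (crossing S))).sum_eq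
      have e1 : l₁.reverse.getLast (by simp [hne l₁ hl₁]) = hd l₁ := by
        rw [List.getLast_reverse]
        simp [hhd, List.headD_eq_head?_getD, List.head?_eq_some_head (hne l₁ hl₁)]
      have e2 : l₂.head (hne l₂ hl₂) = hd l₂ := by
        simp [hhd, List.headD_eq_head?_getD, List.head?_eq_some_head (hne l₂ hl₂)]
      rw [h1, List.map_cons, List.sum_cons, pathCost_append _ _ _ (by simp [hne l₁ hl₁])
        (hne l₂ hl₂), pathCost_reverse _ (crossing_comm S), e1, e2]
      simp only [List.map_cons, List.sum_cons]
      ring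
    have hnew : (∑ S ∈ dichotomies X,
        (2 : ℝ) ^ (((l₁.reverse ++ l₂) :: P').map (pathCost (crossing S))).sum) ≤
        (1 + 10 / √((k + 2 : ℕ) : ℝ)) *
          ∑ S ∈ dichotomies X, (2 : ℝ) ^ (P.map (pathCost (crossing S))).sum := by
      rw [hYc] at hle
      push_cast at hle ⊢
      rw [add_mul, one_mul]
      refine le_trans (le_of_eq ?_) (add_le_add_right hle _)
      rw [← Finset.sum_add_distrib]
      refine Finset.sum_congr rfl fun S _ => ?_
      rw [hcost, pow_add]
      have hc := crossing_le_one S (hd l₁) (hd l₂)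
      interval_cases crossing S (hd l₁) (hd l₂)
      · simp
      · simp
        ring
    calc _ ≤ Real.exp (20 * √((k + 1 : ℕ) : ℝ)) * ((1 + 10 / √((k + 2 : ℕ) : ℝ)) *
          ∑ S ∈ dichotomies X, (2 : ℝ) ^ (P.map (pathCost (crossing S))).sum) := by gcongr
      _ ≤ _ := by
        rw [← mul_assoc, mul_comm (Real.exp _)]
        exact mul_le_mul_of_nonneg_right (one_add_div_sqrt_mul_exp_le k) (by positivity)

/-- **Spanning paths with low crossing number** (Welzl): a finite planar point set has a Hamiltonian
path that every line crosses `O(√n)` times. -/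
lemma exists_path_crossing_le (X : Finset Plane) (hX : X.Nonempty) :
    ∃ l : List Plane, l.Perm X.toList ∧
      ∀ S ∈ dichotomies X, ((pathCost (crossing S) l : ℕ) : ℝ) ≤ 60 * √(X.card : ℝ) := by
  classical
  obtain ⟨k, hk⟩ : ∃ k, X.card = k + 1 := ⟨X.card - 1, by have := hX.card_pos; omega⟩
  have hflat : (X.toList.map fun x => [x]).flatten = X.toList := by
    induction X.toList with
    | nil => rfl
    | cons a t ih => simp [ih]
  obtain ⟨l, hl, hc⟩ := exists_join_paths X k (X.toList.map fun x => [x]) (by simp [hk])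
    (by simp) (by rw [hflat]; exact X.nodup_toList) (by rw [hflat]; simp)
  rw [hflat] at hl
  refine ⟨l, hl, fun S hS => ?_⟩
  have hsum : (∑ S ∈ dichotomies X,
      (2 : ℝ) ^ ((X.toList.map fun x => [x]).map (pathCost (crossing S))).sum) =
      (dichotomies X).card := by
    have : ∀ S, ((X.toList.map fun x => [x]).map (pathCost (crossing S))).sum = 0 := by
      intro S
      rw [List.map_map]
      apply List.sum_eq_zero
      intro m hm
      obtain ⟨x, -, rfl⟩ := List.mem_map.1 hm
      rfl
    simp only [this, pow_zero, Finset.sum_const, nsmul_eq_mul, mul_one]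
  rw [hsum, ← hk] at hc
  set s := √(X.card : ℝ) with hs
  have hs2 : s ^ 2 = X.card := Real.sq_sqrt (by positivity)
  have hs0 : 0 ≤ s := Real.sqrt_nonneg _
  have hcard : ((dichotomies X).card : ℝ) ≤ Real.exp (6 * s) := by
    calc ((dichotomies X).card : ℝ) ≤ (X.card + 1) ^ 3 := by exact_mod_cast card_dichotomies_le X
      _ ≤ ((s + 1) ^ 2) ^ 3 := by
        gcongr
        nlinarith
      _ ≤ (Real.exp s ^ 2) ^ 3 := by
        gcongr
        exact Real.add_one_le_exp s
      _ = Real.exp (6 * s) := by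
        rw [← Real.exp_nat_mul, ← Real.exp_nat_mul]
        congr 1
        push_cast
        ring
  have h1 : (2 : ℝ) ^ pathCost (crossing S) l ≤ Real.exp (26 * s) := by
    calc (2 : ℝ) ^ pathCost (crossing S) l
        ≤ ∑ S ∈ dichotomies X, (2 : ℝ) ^ pathCost (crossing S) l :=
          Finset.single_le_sum (f := fun S => (2 : ℝ) ^ pathCost (crossing S) l)
            (fun _ _ => by positivity) hS
      _ ≤ Real.exp (20 * s) * Real.exp (6 * s) := hc.trans (by gcongr)
      _ = Real.exp (26 * s) := by rw [← Real.exp_add]; congr 1; ring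
  have h2 : ((pathCost (crossing S) l : ℕ) : ℝ) * Real.log 2 ≤ 26 * s := by
    rw [← Real.log_pow]
    exact (Real.log_le_iff_le_exp (by positivity)).2 h1
  have h3 := Real.log_two_gt_d9
  have h4 : (0 : ℝ) ≤ (pathCost (crossing S) l : ℕ) := Nat.cast_nonneg _
  nlinarith

/-! ### Simple polygons with low crossing number -/

/-- If the edges `a b` and `c d` intersect, no dichotomy crosses the pair of edges `a c`, `b d` more
often than the pair `a b`, `c d`. -/
lemma crossing_exchange_le {X S : Finset Plane} (hS : S ∈ dichotomies X) {a b c d : Plane}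
    (ha : a ∈ X) (hb : b ∈ X) (hc : c ∈ X) (hd : d ∈ X)
    (h : ¬ Disjoint (segment ℝ a b) (segment ℝ c d)) :
    crossing S a c + crossing S b d ≤ crossing S a b + crossing S c d := by
  obtain ⟨g, hg⟩ := exists_affineEval_of_mem_dichotomies hS
  obtain ⟨z, hz, hz'⟩ := Set.not_disjoint_iff.1 h
  rw [segment_eq_image_lineMap] at hz hz'
  obtain ⟨s, hs, hsz⟩ := hz
  obtain ⟨t, ht, htz⟩ := hz'
  have e : (1 - s) * affineEval g a + s * affineEval g b =
      (1 - t) * affineEval g c + t * affineEval g d := by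
    rw [← affineEval_lineMap, ← affineEval_lineMap, hsz, htz]
  have hpos : ∀ u v r : ℝ, r ∈ Set.Icc (0 : ℝ) 1 → 0 < u → 0 < v → 0 < (1 - r) * u + r * v := by
    intro u v r hr hu hv
    rcases hr.1.eq_or_lt with rfl | h0
    · simpa using hu
    · exact add_pos_of_nonneg_of_pos (mul_nonneg (by linarith [hr.2]) hu.le) (mul_pos h0 hv)
  have hA := hg a ha
  have hB := hg b hb
  have hC := hg c hc
  have hD := hg d hd
  unfold crossing
  by_cases h1 : a ∈ S <;> by_cases h2 : b ∈ S <;> by_cases h3 : c ∈ S <;> by_cases h4 : d ∈ S <;>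
    simp only [h1, h2, h3, h4, iff_self, iff_true, iff_false, not_true, if_true,
      if_false] <;> try omega
  · exfalso
    have p1 := hpos _ _ s hs (hA.1 h1) (hB.1 h2)
    have p2 := hpos _ _ t ht (neg_pos.2 (hC.2 h3)) (neg_pos.2 (hD.2 h4))
    linarith
  · exfalso
    have p1 := hpos _ _ s hs (neg_pos.2 (hA.2 h1)) (neg_pos.2 (hB.2 h2))
    have p2 := hpos _ _ t ht (hC.1 h3) (hD.1 h4)
    linarith

/-- Exchanging two intersecting edges `a b` and `c d` for `a c` and `b d` decreases the total
length, by the strict triangle inequality. -/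
lemma dist_exchange_lt {a b c d : Plane} (h1 : ¬ Collinear ℝ {a, b, c})
    (h2 : ¬ Collinear ℝ {c, a, d}) (h : ¬ Disjoint (segment ℝ a b) (segment ℝ c d)) :
    dist a c + dist b d < dist a b + dist c d := by
  obtain ⟨z, hz, hz'⟩ := Set.not_disjoint_iff.1 h
  have e1 := dist_add_dist_of_mem_segment hz
  have e2 := dist_add_dist_of_mem_segment hz'
  have t1 := dist_triangle a z c
  have t2 := dist_triangle b z d
  have hne : dist a z + dist z c ≠ dist a c := by
    intro heq
    have w1 : Wbtw ℝ a z c := dist_add_dist_eq_iff.1 heq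
    have w2 : Wbtw ℝ a z b := dist_add_dist_eq_iff.1 e1
    have haz : a ≠ z := by
      rintro rfl
      exact h2 (dist_add_dist_eq_iff.1 e2).collinear
    refine h1 (Collinear.subset ?_ (collinear_insert_insert_of_mem_affineSpan_pair
      (w2.right_mem_affineSpan_of_left_ne haz) (w1.right_mem_affineSpan_of_left_ne haz)))
    intro x hx
    simp only [Set.mem_insert_iff, Set.mem_singleton_iff] at hx ⊢
    tauto
  have t3 := lt_of_le_of_ne t1 (Ne.symm hne)
  rw [dist_comm z b] at e1
  rw [dist_comm c z] at e2
  linarith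

lemma getD_append_pred_length {α : Type*} (d : α) {A : List α} (B : List α) (hA : A ≠ []) :
    (A ++ B).getD (A.length - 1) d = A.getLast hA := by
  have : A.length ≠ 0 := by simpa using hA
  rw [List.getD_append _ _ _ _ (by omega), List.getLast_eq_getElem,
    List.getD_eq_getElem _ _ (by omega)]

lemma getD_append_length {α : Type*} (d : α) (A : List α) {B : List α} (hB : B ≠ []) :
    (A ++ B).getD A.length d = B.head hB := by
  obtain ⟨b, t, rfl⟩ := List.exists_cons_of_ne_nil hB
  simp

/-- Points in general position are the vertices of a simple polygon that every line crosses
`O(√n)` times: take the shortest of all Hamiltonian cycles with few crossings, and note that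
exchanging a pair of intersecting edges would shorten it further. -/
lemma exists_simple_polygon (X : Finset Plane) (hX : X.Nonempty) (hgp : InGeneralPosition X) :
    ∃ p : ℕ → Plane, p X.card = p 0 ∧ (∀ i < X.card, ∀ j < X.card, p i = p j → i = j) ∧
      (∀ x, x ∈ X ↔ ∃ i < X.card, p i = x) ∧
      (∀ S ∈ dichotomies X, ((∑ i ∈ Finset.range X.card, crossing S (p i) (p (i + 1)) : ℕ) : ℝ) ≤
        60 * √(X.card : ℝ) + 1) ∧
      ∀ i j, i + 1 < j → j < X.card → ¬ (i = 0 ∧ j + 1 = X.card) →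
        Disjoint (segment ℝ (p i) (p (i + 1))) (segment ℝ (p j) (p (j + 1))) := by
  classical
  set n := X.card with hn
  set K : ℝ := 60 * √(n : ℝ) + 1 with hK
  set close : List Plane → List Plane := fun l => l ++ [l.headD 0] with hclose
  set F := (X.toList.permutations.toFinset).filter fun l =>
    ∀ S ∈ dichotomies X, ((pathCost (crossing S) (close l) : ℕ) : ℝ) ≤ K with hF
  have hmemF : ∀ l, l ∈ F ↔ l.Perm X.toList ∧
      ∀ S ∈ dichotomies X, ((pathCost (crossing S) (close l) : ℕ) : ℝ) ≤ K := by
    intro l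
    simp [hF, List.mem_permutations]
  have hFne : F.Nonempty := by
    obtain ⟨l, hl, hc⟩ := exists_path_crossing_le X hX
    refine ⟨l, (hmemF l).2 ⟨hl, fun S hS => ?_⟩⟩
    have hl0 : l ≠ [] := by
      rintro rfl
      exact hX.toList_ne_nil (List.nil_perm.1 hl)
    rw [hclose, pathCost_append _ _ _ hl0 (by simp)]
    have h1 := hc S hS
    have h2 := crossing_le_one S (l.getLast hl0) ([l.headD 0].head (by simp))
    have h3 : ((crossing S (l.getLast hl0) ([l.headD 0].head (by simp)) : ℕ) : ℝ) ≤ 1 := by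
      exact_mod_cast h2
    push_cast
    simp only [pathCost_singleton, Nat.cast_zero, add_zero]
    exact add_le_add h1 h3
  obtain ⟨l, hlF, hmin⟩ := Finset.exists_min_image F (fun l => pathCost dist (close l)) hFne
  obtain ⟨hperm, hcross⟩ := (hmemF l).1 hlF
  have hlen : l.length = n := by rw [hperm.length_eq, Finset.length_toList]
  have hnd : l.Nodup := hperm.nodup_iff.2 X.nodup_toList
  have hmem : ∀ x, x ∈ l ↔ x ∈ X := fun x => by rw [hperm.mem_iff, Finset.mem_toList]
  have hn0 : 0 < n := hX.card_pos
  set p : ℕ → Plane := fun i => (close l).getD i 0 with hp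
  have hpl : ∀ i (hi : i < n), p i = l[i]'(by omega) := by
    intro i hi
    simp only [hp, hclose]
    rw [List.getD_append _ _ _ _ (by omega), List.getD_eq_getElem _ _ (by omega)]
  have hpn : p n = p 0 := by
    rw [hpl 0 hn0]
    simp only [hp, hclose]
    rw [← hlen, getD_append_length _ _ (by simp)]
    cases l with
    | nil => simp at hlen; omega
    | cons a t => simp
  have hpinj : ∀ i < n, ∀ j < n, p i = p j → i = j := by
    intro i hi j hj h
    rw [hpl i hi, hpl j hj] at h
    exact (hnd.getElem_inj_iff).1 h
  have hpX : ∀ i < n, p i ∈ X := by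
    intro i hi
    rw [hpl i hi, ← hmem]
    exact List.getElem_mem _
  refine ⟨p, hpn, hpinj, ?_, ?_, ?_⟩
  · intro x
    rw [← hmem, List.mem_iff_getElem]
    constructor
    · rintro ⟨i, hi, rfl⟩
      exact ⟨i, by omega, hpl i (by omega)⟩
    · rintro ⟨i, hi, rfl⟩
      exact ⟨i, by omega, (hpl i hi).symm⟩
  · intro S hS
    have := hcross S hS
    rw [pathCost_eq_sum _ 0] at this
    have hcl : (close l).length - 1 = n := by simp [hclose, hlen]
    rwa [hcl] at this
  · intro i j hij hj hnot
    by_contra hdis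
    -- The fourth vertex has an index below `n`, different from the other three.
    obtain ⟨k, hk, hkp, hki, hki', hkj⟩ :
        ∃ k, k < n ∧ p (j + 1) = p k ∧ k ≠ i ∧ k ≠ i + 1 ∧ k ≠ j := by
      by_cases h : j + 1 = n
      · exact ⟨0, hn0, by rw [h, hpn], fun h0 => hnot ⟨h0.symm, h⟩, by omega, by omega⟩
      · exact ⟨j + 1, by omega, rfl, by omega, by omega, by omega⟩
    have hne : ∀ u < n, ∀ v < n, u ≠ v → p u ≠ p v := fun u hu v hv huv h =>
      huv (hpinj u hu v hv h)
    have hi : i < n := by omega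
    have hi' : i + 1 < n := by omega
    have hcol : ∀ u < n, ∀ v < n, ∀ w < n, u ≠ v → u ≠ w → v ≠ w →
        ¬ Collinear ℝ {p u, p v, p w} := fun u hu v hv w hw huv huw hvw =>
      hgp _ (hpX u hu) _ (hpX v hv) _ (hpX w hw) (hne u hu v hv huv) (hne u hu w hw huw)
        (hne v hv w hw hvw)
    have hlt := dist_exchange_lt (hcol i hi (i + 1) hi' j hj (by omega) (by omega) (by omega))
      (hkp ▸ hcol j hj i hi k hk (by omega) hkj.symm hki.symm) hdis
    set L₁ := l.take (i + 1) with hL₁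
    set L₂ := (l.drop (i + 1)).take (j - i) with hL₂
    set M := l.drop (j + 1) with hM
    have hl : l = L₁ ++ L₂ ++ M := by
      have h1 : M = (l.drop (i + 1)).drop (j - i) := by
        rw [List.drop_drop, hM]
        congr 1
        omega
      rw [h1, List.append_assoc, List.take_append_drop, List.take_append_drop]
    have hlen1 : L₁.length = i + 1 := by rw [hL₁, List.length_take]; omega
    have hlen2 : L₂.length = j - i := by rw [hL₂, List.length_take, List.length_drop]; omega
    have h1 : L₁ ≠ [] := by intro h; rw [h] at hlen1; simp at hlen1
    have h2 : L₂ ≠ [] := by intro h; rw [h] at hlen2; simp at hlen2; omega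
    set L₃ := M ++ [l.headD 0] with hL₃
    have h3 : L₃ ≠ [] := by simp [hL₃]
    have hc1 : close l = L₁ ++ L₂ ++ L₃ := by
      have : close l = l ++ [l.headD 0] := rfl
      rw [this, hL₃, ← List.append_assoc, ← hl]
    set l' := L₁ ++ L₂.reverse ++ M with hl'
    have hhead : l'.headD 0 = l.headD 0 := by
      obtain ⟨a, t, hat⟩ := List.exists_cons_of_ne_nil h1
      rw [hl', hl, hat]
      rfl
    have hc2 : close l' = L₁ ++ L₂.reverse ++ L₃ := by
      have : close l' = l' ++ [l'.headD 0] := rfl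
      rw [this, hhead, hL₃, hl', List.append_assoc _ M]
    have e1 : L₁.getLast h1 = p i := by
      have := getD_append_pred_length (0 : Plane) (L₂ ++ L₃) h1
      rw [← List.append_assoc, ← hc1, hlen1] at this
      exact this.symm
    have e2 : L₂.head h2 = p (i + 1) := by
      have := getD_append_length (0 : Plane) L₁ (B := L₂ ++ L₃) (by simp [h2])
      rw [← List.append_assoc, ← hc1, hlen1, List.head_append_of_ne_nil h2] at this
      exact this.symm
    have hlen12 : (L₁ ++ L₂).length = j + 1 := by rw [List.length_append, hlen1, hlen2]; omega
    have e3 : L₂.getLast h2 = p j := by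
      have := getD_append_pred_length (0 : Plane) L₃ (A := L₁ ++ L₂) (by simp [h1])
      rw [← hc1, hlen12, List.getLast_append_of_right_ne_nil _ _ h2] at this
      exact this.symm
    have e4 : L₃.head h3 = p (j + 1) := by
      have := getD_append_length (0 : Plane) (L₁ ++ L₂) h3
      rw [← hc1, hlen12] at this
      exact this.symm
    have hl'F : l' ∈ F := by
      refine (hmemF l').2 ⟨?_, fun S hS => ?_⟩
      · refine List.Perm.trans ?_ hperm
        rw [hl', hl]
        exact ((L₂.reverse_perm).append_left L₁).append_right M
      · obtain ⟨m, hm1, hm2⟩ := pathCost_reverse_middle (crossing S) (crossing_comm S)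
          L₁ L₂ L₃ h1 h2 h3
        refine le_trans ?_ (hcross S hS)
        rw [hc1, hc2, hm1, hm2, e1, e2, e3, e4]
        have := crossing_exchange_le hS (hpX i hi) (hpX _ hi') (hpX j hj)
          (hkp ▸ hpX k hk) hdis
        exact_mod_cast Nat.add_le_add_left this m
    have hle := hmin l' hl'F
    obtain ⟨m, hm1, hm2⟩ := pathCost_reverse_middle (dist : Plane → Plane → ℝ) dist_comm
      L₁ L₂ L₃ h1 h2 h3
    simp only [hc1, hc2] at hle
    rw [hm1, hm2, e1, e2, e3, e4] at hle
    linarith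

/-! ### Parabolic arcs -/

/-- The cross product (determinant) of two plane vectors. -/
def planeCross (u v : Plane) : ℝ := u 0 * v 1 - u 1 * v 0

/-- The plane vector `u`, rotated by a right angle. -/
noncomputable def rot (u : Plane) : Plane := !₂[-u 1, u 0]

@[simp] lemma rot_zero (u : Plane) : rot u 0 = -u 1 := rfl

@[simp] lemma rot_one (u : Plane) : rot u 1 = u 0 := rfl

/-- The parabolic arc from `p` to `q`, parametrized by `[0, 1]`, whose height above the segment
from `p` to `q` is proportional to `ε`. -/
noncomputable def arc (ε : ℝ) (p q : Plane) (t : ℝ) : Plane :=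
  p + t • (q - p) + (ε * t * (1 - t)) • rot (q - p)

lemma arc_zero (ε : ℝ) (p q : Plane) : arc ε p q 0 = p := by simp [arc]

lemma arc_one (ε : ℝ) (p q : Plane) : arc ε p q 1 = q := by simp [arc]

lemma arc_zero_height (p q : Plane) (t : ℝ) : arc 0 p q t = AffineMap.lineMap p q t := by
  simp [arc, AffineMap.lineMap_apply, add_comm]

lemma continuous_arc (p q : Plane) : Continuous fun a : ℝ × ℝ => arc a.1 p q a.2 := by
  unfold arc
  fun_prop

lemma continuous_arc_right (ε : ℝ) (p q : Plane) : Continuous (arc ε p q) :=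
  (continuous_arc p q).comp (Continuous.prodMk_right ε)

lemma coord_sub_sq_pos {p q : Plane} (h : p ≠ q) : 0 < (q 0 - p 0) ^ 2 + (q 1 - p 1) ^ 2 := by
  by_contra hcon
  apply h
  ext i
  fin_cases i
  · simp only [Fin.zero_eta]
    nlinarith [sq_nonneg (q 0 - p 0), sq_nonneg (q 1 - p 1)]
  · simp only [Fin.mk_one]
    nlinarith [sq_nonneg (q 0 - p 0), sq_nonneg (q 1 - p 1)]

lemma arc_injective (ε : ℝ) {p q : Plane} (h : p ≠ q) : Function.Injective (arc ε p q) := by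
  intro s t hst
  have h0 := congrArg (fun z : Plane => z 0) hst
  have h1 := congrArg (fun z : Plane => z 1) hst
  simp only [arc, PiLp.add_apply, PiLp.smul_apply, PiLp.sub_apply, smul_eq_mul, rot_zero,
    rot_one] at h0 h1
  have hpos := coord_sub_sq_pos h
  have : (s - t) * ((q 0 - p 0) ^ 2 + (q 1 - p 1) ^ 2) = 0 := by
    linear_combination (q 0 - p 0) * h0 + (q 1 - p 1) * h1
  rcases mul_eq_zero.1 this with h | h
  · linarith
  · exact absurd h hpos.ne'

lemma affineEval_arc (g : Fin 3 → ℝ) (ε : ℝ) (p q : Plane) (t : ℝ) :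
    affineEval g (arc ε p q t) = (1 - t) * affineEval g p + t * affineEval g q +
      ε * t * (1 - t) * (g 1 * (q 0 - p 0) - g 0 * (q 1 - p 1)) := by
  simp only [affineEval, arc, PiLp.add_apply, PiLp.smul_apply, PiLp.sub_apply, smul_eq_mul,
    rot_zero, rot_one]
  ring

/-- Without exception, a line meets a (nondegenerate) parabolic arc in at most two points. -/
lemma encard_arc_inter_le_two (g : Fin 3 → ℝ) (hg : g 0 ≠ 0 ∨ g 1 ≠ 0) {ε : ℝ} (hε : ε ≠ 0)
    {p q : Plane} (h : p ≠ q) : {t | affineEval g (arc ε p q t) = 0}.encard ≤ 2 := by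
  by_contra hcon
  have h3 : (3 : ℕ∞) ≤ {t | affineEval g (arc ε p q t) = 0}.encard :=
    Order.add_one_le_of_lt (not_le.1 hcon)
  obtain ⟨T, hT, hT3⟩ := Set.exists_subset_encard_eq h3
  obtain ⟨a, b, c, hab, hac, hbc, rfl⟩ := Set.encard_eq_three.1 hT3
  have ha : affineEval g (arc ε p q a) = 0 := hT (by simp)
  have hb : affineEval g (arc ε p q b) = 0 := hT (by simp)
  have hc : affineEval g (arc ε p q c) = 0 := hT (by simp)
  rw [affineEval_arc] at ha hb hc
  set u := affineEval g p
  set v := affineEval g q with hv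
  set m := ε * (g 1 * (q 0 - p 0) - g 0 * (q 1 - p 1)) with hm
  have h1 : (v - u + m) - m * (a + b) = 0 := by
    apply mul_left_cancel₀ (sub_ne_zero.2 hab)
    rw [hm]
    linear_combination ha - hb
  have h2 : (v - u + m) - m * (a + c) = 0 := by
    apply mul_left_cancel₀ (sub_ne_zero.2 hac)
    rw [hm]
    linear_combination ha - hc
  have hm0 : m = 0 := by
    have : (b - c) * m = 0 := by linear_combination h2 - h1
    exact (mul_eq_zero.1 this).resolve_left (sub_ne_zero.2 hbc)
  have hvu : v - u = 0 := by
    rw [hm0] at h1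
    linarith
  have hd : g 1 * (q 0 - p 0) - g 0 * (q 1 - p 1) = 0 := (mul_eq_zero.1 hm0).resolve_left hε
  have hd' : g 0 * (q 0 - p 0) + g 1 * (q 1 - p 1) = 0 := by
    have : v - u = g 0 * (q 0 - p 0) + g 1 * (q 1 - p 1) := by
      simp only [hv, u, affineEval]
      ring
    rw [← this, hvu]
  have hpos := coord_sub_sq_pos h
  rcases hg with hg | hg
  · have : g 0 * ((q 0 - p 0) ^ 2 + (q 1 - p 1) ^ 2) = 0 := by
      linear_combination (q 0 - p 0) * hd' - (q 1 - p 1) * hd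
    exact (mul_ne_zero hg hpos.ne') this
  · have : g 1 * ((q 0 - p 0) ^ 2 + (q 1 - p 1) ^ 2) = 0 := by
      linear_combination (q 1 - p 1) * hd' + (q 0 - p 0) * hd
    exact (mul_ne_zero hg hpos.ne') this

lemma planeCross_ne_zero {a b c : Plane} (hab : a ≠ b) (h : ¬ Collinear ℝ {a, b, c}) :
    planeCross (b - a) (c - a) ≠ 0 := by
  intro h0
  apply h
  have hpos := coord_sub_sq_pos hab
  rw [collinear_iff_of_mem (p₀ := a) (by simp)]
  refine ⟨b - a, ?_⟩
  intro x hx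
  simp only [Set.mem_insert_iff, Set.mem_singleton_iff] at hx
  rcases hx with rfl | rfl | rfl
  · exact ⟨0, by simp⟩
  · exact ⟨1, by simp⟩
  · refine ⟨((b 0 - a 0) * (x 0 - a 0) + (b 1 - a 1) * (x 1 - a 1)) /
      ((b 0 - a 0) ^ 2 + (b 1 - a 1) ^ 2), ?_⟩
    simp only [planeCross, PiLp.sub_apply] at h0
    ext i
    fin_cases i
    · simp only [Fin.zero_eta, vadd_eq_add, PiLp.add_apply, PiLp.smul_apply, PiLp.sub_apply,
        smul_eq_mul]
      field_simp
      linear_combination (b 1 - a 1) * -h0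
    · simp only [Fin.mk_one, vadd_eq_add, PiLp.add_apply, PiLp.smul_apply, PiLp.sub_apply,
        smul_eq_mul]
      field_simp
      linear_combination (b 0 - a 0) * h0

/-- Flat arcs along disjoint segments are disjoint. -/
lemma eventually_arc_ne_of_disjoint {a b c d : Plane}
    (h : Disjoint (segment ℝ a b) (segment ℝ c d)) :
    ∀ᶠ ε in 𝓝 (0 : ℝ), ∀ x ∈ Set.Icc (0 : ℝ) 1 ×ˢ Set.Icc (0 : ℝ) 1,
      arc ε a b x.1 ≠ arc ε c d x.2 := by
  refine (isCompact_Icc.prod isCompact_Icc).eventually_forall_of_forall_eventually ?_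
  rintro ⟨s, t⟩ ⟨hs, ht⟩
  have hc1 : Continuous fun z : ℝ × (ℝ × ℝ) => arc z.1 a b z.2.1 :=
    (continuous_arc a b).comp (by fun_prop : Continuous fun z : ℝ × (ℝ × ℝ) => (z.1, z.2.1))
  have hc2 : Continuous fun z : ℝ × (ℝ × ℝ) => arc z.1 c d z.2.2 :=
    (continuous_arc c d).comp (by fun_prop : Continuous fun z : ℝ × (ℝ × ℝ) => (z.1, z.2.2))
  refine (hc1.continuousAt.ne_iff_eventually_ne hc2.continuousAt).1 ?_
  simp only [arc_zero_height]
  refine Set.disjoint_iff_forall_ne.1 h ?_ ?_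
  · rw [segment_eq_image_lineMap]
    exact ⟨s, hs, rfl⟩
  · rw [segment_eq_image_lineMap]
    exact ⟨t, ht, rfl⟩

/-- Flat arcs along two segments that meet at an angle only meet in the common endpoint. -/
lemma eventually_arc_ne_of_adjacent {a b c : Plane} (h : planeCross (a - b) (c - b) ≠ 0) :
    ∀ᶠ ε in 𝓝 (0 : ℝ), ∀ x ∈ Set.Icc (0 : ℝ) 1 ×ˢ Set.Icc (0 : ℝ) 1, x.1 ≠ 1 →
      arc ε a b x.1 ≠ arc ε b c x.2 := by
  have key : ∀ᶠ ε in 𝓝 (0 : ℝ), ∀ x ∈ Set.Icc (0 : ℝ) 1 ×ˢ Set.Icc (0 : ℝ) 1,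
      (1 - ε ^ 2 * x.1 * (1 - x.2)) * planeCross (a - b) (c - b) + ε * (x.1 + (1 - x.2)) *
        ((a 0 - b 0) * (c 0 - b 0) + (a 1 - b 1) * (c 1 - b 1)) ≠ 0 := by
    refine (isCompact_Icc.prod isCompact_Icc).eventually_forall_of_forall_eventually ?_
    rintro ⟨s, t⟩ -
    refine ContinuousAt.eventually_ne (Continuous.continuousAt (by fun_prop)) ?_
    simpa using h
  filter_upwards [key] with ε hε
  rintro ⟨s, t⟩ hst hs heq
  apply hε _ hst
  simp only at hs heq ⊢
  have h0 := congrArg (fun z : Plane => z 0) heq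
  have h1 := congrArg (fun z : Plane => z 1) heq
  simp only [arc, PiLp.add_apply, PiLp.smul_apply, PiLp.sub_apply, smul_eq_mul, rot_zero,
    rot_one] at h0 h1
  simp only [planeCross, PiLp.sub_apply]
  -- The vector from `b` to the common point is `1 - s` times one vector and `t` times another; the
  -- expression in question is the cross product of these two vectors.
  apply mul_left_cancel₀ (sub_ne_zero.2 (Ne.symm hs))
  linear_combination (c 1 - b 1 + ε * (1 - t) * (c 0 - b 0)) * h0 -
    (c 0 - b 0 - ε * (1 - t) * (c 1 - b 1)) * h1

/-- No line is very close to three given noncollinear points. -/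
lemma eventually_not_three_near {a b c : Plane} (h : planeCross (b - a) (c - a) ≠ 0) (R : ℝ) :
    ∀ᶠ ε in 𝓝 (0 : ℝ), ∀ g : Fin 3 → ℝ, (g 0 ≠ 0 ∨ g 1 ≠ 0) →
      ¬ (|affineEval g a| ≤ ε * R * (|g 0| + |g 1|) ∧ |affineEval g b| ≤ ε * R * (|g 0| + |g 1|) ∧
        |affineEval g c| ≤ ε * R * (|g 0| + |g 1|)) := by
  set L := |b 0 - a 0| + |b 1 - a 1| + |c 0 - a 0| + |c 1 - a 1| with hL
  have key : ∀ᶠ ε in 𝓝 (0 : ℝ), 2 * ε * R * L < |planeCross (b - a) (c - a)| := by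
    have hc : Continuous fun ε : ℝ => 2 * ε * R * L := by fun_prop
    refine (hc.tendsto 0).eventually_lt_const ?_
    simpa using h
  filter_upwards [key] with ε hε g hg ⟨ha, hb, hc⟩
  set m := |g 0| + |g 1| with hm
  have hm0 : 0 < m := by
    rcases hg with hg | hg
    · exact add_pos_of_pos_of_nonneg (abs_pos.2 hg) (abs_nonneg _)
    · exact add_pos_of_nonneg_of_pos (abs_nonneg _) (abs_pos.2 hg)
  set U := affineEval g b - affineEval g a with hU
  set V := affineEval g c - affineEval g a with hV
  have hU' : |U| ≤ 2 * (ε * R * m) := (abs_sub _ _).trans (by linarith)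
  have hV' : |V| ≤ 2 * (ε * R * m) := (abs_sub _ _).trans (by linarith)
  set D := planeCross (b - a) (c - a) with hD
  have e0 : g 0 * D = U * (c 1 - a 1) - V * (b 1 - a 1) := by
    simp only [hD, hU, hV, planeCross, affineEval, PiLp.sub_apply]
    ring
  have e1 : g 1 * D = V * (b 0 - a 0) - U * (c 0 - a 0) := by
    simp only [hD, hU, hV, planeCross, affineEval, PiLp.sub_apply]
    ring
  have f0 : |g 0| * |D| ≤ 2 * (ε * R * m) * (|c 1 - a 1| + |b 1 - a 1|) := by
    rw [← abs_mul, e0]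
    refine (abs_sub _ _).trans ?_
    rw [abs_mul, abs_mul, mul_add]
    gcongr
  have f1 : |g 1| * |D| ≤ 2 * (ε * R * m) * (|b 0 - a 0| + |c 0 - a 0|) := by
    rw [← abs_mul, e1]
    refine (abs_sub _ _).trans ?_
    rw [abs_mul, abs_mul, mul_add]
    gcongr
  have : m * |D| ≤ m * (2 * ε * R * L) := by
    rw [hm, add_mul, ← hm, hL]
    linarith
  exact absurd (le_of_mul_le_mul_left this hm0) (not_le.2 hε)

/-- A line that meets a flat arc but does not strictly separate its endpoints passes close to one of
them. -/
lemma near_or_near_of_arc {g : Fin 3 → ℝ} {ε R t : ℝ} (hε : 0 ≤ ε) {p q : Plane}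
    (hR : |q 0 - p 0| + |q 1 - p 1| ≤ R) (ht : t ∈ Set.Icc (0 : ℝ) 1)
    (h0 : affineEval g (arc ε p q t) = 0) (hsep : 0 ≤ affineEval g p * affineEval g q) :
    |affineEval g p| ≤ ε * R * (|g 0| + |g 1|) ∨ |affineEval g q| ≤ ε * R * (|g 0| + |g 1|) := by
  by_contra! hcon
  obtain ⟨hp, hq⟩ := hcon
  rw [affineEval_arc] at h0
  set u := affineEval g p
  set v := affineEval g q
  set B := ε * R * (|g 0| + |g 1|) with hB
  obtain ⟨ht0, ht1⟩ := ht
  have ht1' : 0 ≤ 1 - t := by linarith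
  have h1 : |(1 - t) * u + t * v| = (1 - t) * |u| + t * |v| := by
    rcases mul_nonneg_iff.1 hsep with ⟨hu, hv⟩ | ⟨hu, hv⟩
    · rw [abs_of_nonneg hu, abs_of_nonneg hv, abs_of_nonneg (by positivity)]
    · rw [abs_of_nonpos hu, abs_of_nonpos hv, abs_of_nonpos]
      · ring
      · have := mul_nonpos_of_nonneg_of_nonpos ht1' hu
        have := mul_nonpos_of_nonneg_of_nonpos ht0 hv
        linarith
  have h2 : |(1 - t) * u + t * v| ≤ B := by
    have : (1 - t) * u + t * v =
        -(ε * (t * (1 - t)) * (g 1 * (q 0 - p 0) - g 0 * (q 1 - p 1))) := by linarith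
    rw [this, abs_neg, abs_mul, abs_mul, abs_of_nonneg hε, hB, mul_assoc, mul_assoc]
    refine mul_le_mul_of_nonneg_left ?_ hε
    have h3 : |t * (1 - t)| ≤ 1 := by
      rw [abs_of_nonneg (by positivity)]
      nlinarith
    have h4 : |g 1 * (q 0 - p 0) - g 0 * (q 1 - p 1)| ≤ R * (|g 0| + |g 1|) := by
      refine (abs_sub _ _).trans ?_
      rw [abs_mul, abs_mul]
      have a1 := abs_nonneg (g 0)
      have a2 := abs_nonneg (g 1)
      have a3 := abs_nonneg (q 0 - p 0)
      have a4 := abs_nonneg (q 1 - p 1)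
      have b1 : |g 1| * |q 0 - p 0| ≤ |g 1| * R := by gcongr; linarith
      have b2 : |g 0| * |q 1 - p 1| ≤ |g 0| * R := by gcongr; linarith
      linarith
    calc |t * (1 - t)| * |g 1 * (q 0 - p 0) - g 0 * (q 1 - p 1)|
        ≤ 1 * |g 1 * (q 0 - p 0) - g 0 * (q 1 - p 1)| := by gcongr
      _ ≤ _ := by rw [one_mul]; exact h4
  rw [h1] at h2
  rcases ht0.eq_or_lt with rfl | ht0
  · linarith
  · nlinarith [mul_lt_mul_of_pos_left hq ht0, mul_le_mul_of_nonneg_left hp.le ht1']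

/-! ### The Jordan curve -/

/-- A cyclic sequence of arcs that only meet in consecutive endpoints forms a Jordan curve. -/
lemma isJordanCurve_iUnion_image (n : ℕ) (hn : 0 < n) (α : ℕ → ℝ → Plane)
    (hcont : ∀ i, Continuous (α i)) (hsucc : ∀ i, α i 1 = α (i + 1) 0) (hclose : α n 0 = α 0 0)
    (hinj : ∀ i < n, ∀ j < n, ∀ s ∈ Set.Ico (0 : ℝ) 1, ∀ t ∈ Set.Ico (0 : ℝ) 1,
      α i s = α j t → i = j ∧ s = t) :
    IsJordanCurve (⋃ i ∈ Finset.range n, α i '' Set.Icc 0 1) := by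
  set Γ : ℝ → Plane := fun t => α ⌊t⌋₊ (t - ⌊t⌋₊) with hΓ
  have hΓ1 : ∀ (m : ℕ) (s : ℝ), s ∈ Set.Ico (0 : ℝ) 1 → Γ (m + s) = α m s := by
    intro m s hs
    have : ⌊(m : ℝ) + s⌋₊ = m := by
      rw [Nat.floor_eq_iff (by linarith [hs.1, Nat.cast_nonneg (α := ℝ) m])]
      constructor <;> linarith [hs.1, hs.2]
    simp only [hΓ, this, add_sub_cancel_left]
  have hΓ2 : ∀ m : ℕ, Γ m = α m 0 := by
    intro m
    simpa using hΓ1 m 0 ⟨le_rfl, one_pos⟩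
  have hc : ∀ m : ℕ, ContinuousOn Γ (Set.Icc 0 m) := by
    intro m
    induction m with
    | zero => simp
    | succ m ih =>
      have hu : Set.Icc (0 : ℝ) ((m + 1 : ℕ) : ℝ) =
          Set.Icc 0 (m : ℝ) ∪ Set.Icc (m : ℝ) (m + 1) := by
        rw [Set.Icc_union_Icc_eq_Icc (Nat.cast_nonneg m) (by linarith)]
        push_cast
        rfl
      rw [hu]
      refine ih.union_of_isClosed ?_ isClosed_Icc isClosed_Icc
      have h1 : ContinuousOn (fun t : ℝ => α m (t - m)) (Set.Icc (m : ℝ) (m + 1)) :=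
        ((hcont m).comp (continuous_id.sub continuous_const)).continuousOn
      refine h1.congr ?_
      intro t ht
      rcases ht.2.eq_or_lt with rfl | h
      · have := hΓ2 (m + 1)
        push_cast at this
        rw [this, ← hsucc]
        simp
      · have := hΓ1 m (t - m) ⟨by linarith [ht.1], by linarith⟩
        rwa [add_sub_cancel] at this
  have hn0 : (0 : ℝ) < n := by exact_mod_cast hn
  have : Fact ((0 : ℝ) < n) := ⟨hn0⟩
  have hends : Γ 0 = Γ n := by
    have := hΓ2 0
    rw [Nat.cast_zero] at this
    rw [this, hΓ2, hclose]
  set Δ : AddCircle (n : ℝ) → Plane := AddCircle.liftIco (n : ℝ) 0 Γ with hΔ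
  have hΔc : Continuous Δ := AddCircle.liftIco_zero_continuous hends (hc n)
  have hΔv : ∀ x ∈ Set.Ico (0 : ℝ) n, Δ (x : AddCircle (n : ℝ)) = Γ x := fun x hx =>
    AddCircle.liftIco_zero_coe_apply hx
  have hrep : ∀ y : AddCircle (n : ℝ), ∃ x ∈ Set.Ico (0 : ℝ) n, (x : AddCircle (n : ℝ)) = y := by
    intro y
    have h := (AddCircle.equivIco (n : ℝ) 0 y).2
    exact ⟨_, ⟨h.1, by linarith [h.2]⟩, AddCircle.coe_equivIco⟩
  have hfloor : ∀ x ∈ Set.Ico (0 : ℝ) n, ⌊x⌋₊ < n ∧ x - ⌊x⌋₊ ∈ Set.Ico (0 : ℝ) 1 := by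
    intro x hx
    refine ⟨(Nat.floor_lt hx.1).2 hx.2, ?_, ?_⟩
    · linarith [Nat.floor_le hx.1]
    · linarith [Nat.lt_floor_add_one x]
  have hΔi : Function.Injective Δ := by
    intro y y' h
    obtain ⟨x, hx, rfl⟩ := hrep y
    obtain ⟨x', hx', rfl⟩ := hrep y'
    rw [hΔv x hx, hΔv x' hx'] at h
    obtain ⟨h1, h2⟩ := hfloor x hx
    obtain ⟨h1', h2'⟩ := hfloor x' hx'
    obtain ⟨e1, e2⟩ := hinj _ h1 _ h1' _ h2 _ h2' h
    rw [e1] at e2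
    have : x = x' := by linarith
    rw [this]
  have hΔr : Set.range Δ = ⋃ i ∈ Finset.range n, α i '' Set.Icc 0 1 := by
    apply Set.Subset.antisymm
    · rintro _ ⟨y, rfl⟩
      obtain ⟨x, hx, rfl⟩ := hrep y
      obtain ⟨h1, h2⟩ := hfloor x hx
      rw [hΔv x hx]
      exact Set.mem_biUnion (Finset.mem_coe.2 (Finset.mem_range.2 h1))
        ⟨_, Set.Ico_subset_Icc_self h2, rfl⟩
    · intro z hz
      simp only [Set.mem_iUnion, Finset.mem_range] at hz
      obtain ⟨i, hi, s, hs, rfl⟩ := hz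
      have hval : ∀ (m : ℕ) (s : ℝ), m < n → s ∈ Set.Ico (0 : ℝ) 1 → α m s ∈ Set.range Δ := by
        intro m s hm hs
        refine ⟨((m + s : ℝ) : AddCircle (n : ℝ)), ?_⟩
        have hm' : ((m + 1 : ℕ) : ℝ) ≤ n := by exact_mod_cast hm
        push_cast at hm'
        rw [hΔv _ ⟨by linarith [hs.1, Nat.cast_nonneg (α := ℝ) m], by linarith [hs.2]⟩, hΓ1 m s hs]
      rcases hs.2.eq_or_lt with rfl | h
      · rw [hsucc]
        by_cases hin : i + 1 = n
        · rw [hin, hclose]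
          exact hval 0 0 hn ⟨le_rfl, one_pos⟩
        · exact hval (i + 1) 0 (by omega) ⟨le_rfl, one_pos⟩
      · exact hval i s hi ⟨hs.1, h⟩
  refine ⟨Δ ∘ (AddCircle.homeomorphCircle hn0.ne').symm, hΔc.comp (Homeomorph.continuous _),
    hΔi.comp (Homeomorph.injective _), ?_⟩
  rw [Set.range_comp, (Homeomorph.surjective _).range_eq, Set.image_univ, hΔr]

/-- Every line of the plane lies in the zero set of a nonconstant affine function. -/
lemma exists_affineEval_eq_zero_on_line {p q : Plane} (h : p ≠ q) :
    ∃ g : Fin 3 → ℝ, (g 0 ≠ 0 ∨ g 1 ≠ 0) ∧ ∀ x ∈ line[ℝ, p, q], affineEval g x = 0 := by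
  refine ⟨![q 1 - p 1, -(q 0 - p 0), (q 0 - p 0) * p 1 - (q 1 - p 1) * p 0], ?_, ?_⟩
  · by_contra! hcon
    have h0 : q 1 - p 1 = 0 := hcon.1
    have h1 : -(q 0 - p 0) = 0 := hcon.2
    have := coord_sub_sq_pos h
    rw [h0, neg_eq_zero.1 h1] at this
    simp at this
  · intro x hx
    obtain ⟨t, rfl⟩ := mem_affineSpan_pair_iff_exists_lineMap_eq.1 hx
    rw [affineEval_lineMap]
    simp [affineEval]
    ring

/-- For at least three points in general position, a simple polygon crossed `O(√n)` times by every
line becomes the required curve when its edges are replaced by flat parabolic arcs. -/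
lemma exists_jordanCurve_of_three_le_card (X : Finset Plane) (hX : 3 ≤ X.card)
    (hgp : InGeneralPosition X) :
    ∃ J : Set Plane, IsJordanCurve J ∧ (X : Set Plane) ⊆ J ∧
      ∃ d : ℕ, (d : ℝ) ≤ 130 * √(X.card : ℝ) ∧ ∀ p q : Plane, p ≠ q →
        (J ∩ (line[ℝ, p, q] : Set Plane)).encard ≤ (d : ℕ∞) := by
  classical
  have hne : X.Nonempty := Finset.card_pos.1 (by omega)
  obtain ⟨p, hpn, hpinj, hpX, hcr, hdisj⟩ := exists_simple_polygon X hne hgp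
  set n := X.card with hn
  have hpmem : ∀ i < n, p i ∈ X := fun i hi => (hpX _).2 ⟨i, hi, rfl⟩
  have hpsucc : ∀ i < n, ∃ k < n, p (i + 1) = p k ∧ (k = i + 1 ∨ i + 1 = n ∧ k = 0) := by
    intro i hi
    by_cases h : i + 1 = n
    · exact ⟨0, by omega, by rw [h, hpn], Or.inr ⟨h, rfl⟩⟩
    · exact ⟨i + 1, by omega, rfl, Or.inl rfl⟩
  have hpmem' : ∀ i < n, p (i + 1) ∈ X := by
    intro i hi
    obtain ⟨k, hk, h, -⟩ := hpsucc i hi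
    exact h ▸ hpmem k hk
  have hedge : ∀ i < n, p i ≠ p (i + 1) := by
    intro i hi h
    obtain ⟨k, hk, h', hki⟩ := hpsucc i hi
    have := hpinj i hi k hk (h.trans h')
    omega
  -- A bound for the extent of the edges.
  obtain ⟨R, hR⟩ : ∃ R : ℝ, ∀ a ∈ X, ∀ b ∈ X, |b 0 - a 0| + |b 1 - a 1| ≤ R := by
    obtain ⟨R, hR⟩ := (Set.Finite.bddAbove (Set.toFinite
      ((fun z : Plane × Plane => |z.2 0 - z.1 0| + |z.2 1 - z.1 1|) '' (X ×ˢ X : Finset _))))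
    refine ⟨R, fun a ha b hb => hR ⟨(a, b), ?_, rfl⟩⟩
    simp [ha, hb]
  have hcross : ∀ a ∈ X, ∀ b ∈ X, ∀ c ∈ X, a ≠ b → a ≠ c → b ≠ c →
      planeCross (b - a) (c - a) ≠ 0 := fun a ha b hb c hc hab hac hbc =>
    planeCross_ne_zero hab (hgp a ha b hb c hc hab hac hbc)
  have ev1 : ∀ᶠ ε in 𝓝 (0 : ℝ), ∀ a ∈ X, ∀ b ∈ X, ∀ c ∈ X, a ≠ b → a ≠ c → b ≠ c →
      ∀ g : Fin 3 → ℝ, (g 0 ≠ 0 ∨ g 1 ≠ 0) →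
      ¬ (|affineEval g a| ≤ ε * R * (|g 0| + |g 1|) ∧ |affineEval g b| ≤ ε * R * (|g 0| + |g 1|) ∧
        |affineEval g c| ≤ ε * R * (|g 0| + |g 1|)) := by
    simp only [Finset.eventually_all]
    intro a ha b hb c hc
    by_cases h : a ≠ b ∧ a ≠ c ∧ b ≠ c
    · filter_upwards [eventually_not_three_near (hcross a ha b hb c hc h.1 h.2.1 h.2.2) R]
        with ε hε _ _ _
      exact hε
    · exact Eventually.of_forall fun ε h1 h2 h3 => absurd ⟨h1, h2, h3⟩ h
  have ev2 : ∀ᶠ ε in 𝓝 (0 : ℝ), ∀ i ∈ Finset.range n, ∀ j ∈ Finset.range n, i + 1 < j →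
      ¬ (i = 0 ∧ j + 1 = n) → ∀ x ∈ Set.Icc (0 : ℝ) 1 ×ˢ Set.Icc (0 : ℝ) 1,
      arc ε (p i) (p (i + 1)) x.1 ≠ arc ε (p j) (p (j + 1)) x.2 := by
    simp only [Finset.eventually_all]
    intro i hi j hj
    by_cases h : i + 1 < j ∧ ¬ (i = 0 ∧ j + 1 = n)
    · filter_upwards [eventually_arc_ne_of_disjoint
        (hdisj i j h.1 (Finset.mem_range.1 hj) h.2)] with ε hε _ _
      exact hε
    · exact Eventually.of_forall fun ε h1 h2 => absurd ⟨h1, h2⟩ h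
  have ev3 : ∀ᶠ ε in 𝓝 (0 : ℝ), ∀ a ∈ X, ∀ b ∈ X, ∀ c ∈ X, a ≠ b → a ≠ c → b ≠ c →
      ∀ x ∈ Set.Icc (0 : ℝ) 1 ×ˢ Set.Icc (0 : ℝ) 1, x.1 ≠ 1 →
      arc ε a b x.1 ≠ arc ε b c x.2 := by
    simp only [Finset.eventually_all]
    intro a ha b hb c hc
    by_cases h : a ≠ b ∧ a ≠ c ∧ b ≠ c
    · filter_upwards [eventually_arc_ne_of_adjacent
        (hcross b hb a ha c hc h.1.symm h.2.2 h.2.1)] with ε hε _ _ _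
      exact hε
    · exact Eventually.of_forall fun ε h1 h2 h3 => absurd ⟨h1, h2, h3⟩ h
  obtain ⟨ε, ⟨h1, h2, h3⟩, hε⟩ :=
    (((ev1.and (ev2.and ev3)).filter_mono nhdsWithin_le_nhds).and
      (self_mem_nhdsWithin (a := (0 : ℝ)) (s := Set.Ioi 0))).exists
  replace hε : 0 < ε := hε
  set α : ℕ → ℝ → Plane := fun i => arc ε (p i) (p (i + 1)) with hα
  -- Arcs of edges `i < j` do not meet, apart from common endpoints.
  have hlt : ∀ i j, i < j → j < n → ∀ s ∈ Set.Ico (0 : ℝ) 1, ∀ t ∈ Set.Ico (0 : ℝ) 1,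
      α i s ≠ α j t := by
    intro i j hij hj s hs t ht
    have hs' := Set.Ico_subset_Icc_self hs
    have ht' := Set.Ico_subset_Icc_self ht
    have hi : i < n := by omega
    obtain ⟨k, hk, hkp, hkj⟩ := hpsucc j hj
    have hpne : ∀ a < n, ∀ b < n, a ≠ b → p a ≠ p b := fun a ha b hb hab h =>
      hab (hpinj a ha b hb h)
    by_cases hc1 : j = i + 1
    · subst hc1
      simp only [hα]
      rw [hkp]
      exact h3 _ (hpmem i hi) _ (hpmem _ hj) _ (hpmem k hk) (hpne _ hi _ hj (by omega))
        (hpne _ hi _ hk (by omega)) (hpne _ hj _ hk (by omega)) (s, t) ⟨hs', ht'⟩ hs.2.ne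
    · by_cases hc2 : i = 0 ∧ j + 1 = n
      · obtain ⟨rfl, hjn⟩ := hc2
        have hk0 : k = 0 := by omega
        subst hk0
        simp only [hα]
        rw [hkp]
        exact (h3 _ (hpmem j hj) _ (hpmem 0 hi) _ (hpmem 1 (by omega))
          (hpne _ hj _ hi (by omega)) (hpne _ hj _ (by omega) (by omega))
          (hpne _ hi _ (by omega) (by omega)) (t, s) ⟨ht', hs'⟩ ht.2.ne).symm
      · exact h2 i (Finset.mem_range.2 hi) j (Finset.mem_range.2 hj) (by omega) hc2
          (s, t) ⟨hs', ht'⟩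
  refine ⟨⋃ i ∈ Finset.range n, α i '' Set.Icc 0 1, ?_, ?_, ⌊130 * √(n : ℝ)⌋₊,
    Nat.floor_le (by positivity), ?_⟩
  · refine isJordanCurve_iUnion_image n (by omega) α (fun i => continuous_arc_right _ _ _) ?_ ?_ ?_
    · intro i
      simp only [hα, arc_zero, arc_one]
    · simp only [hα, arc_zero, hpn]
    · intro i hi j hj s hs t ht h
      rcases lt_trichotomy i j with hij | rfl | hij
      · exact absurd h (hlt i j hij hj s hs t ht)
      · exact ⟨rfl, arc_injective ε (hedge i hi) h⟩
      · exact absurd h.symm (hlt j i hij hi t ht s hs)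
  · intro x hx
    obtain ⟨i, hi, rfl⟩ := (hpX x).1 hx
    exact Set.mem_biUnion (Finset.mem_coe.2 (Finset.mem_range.2 hi))
      ⟨0, ⟨le_rfl, zero_le_one⟩, arc_zero _ _ _⟩
  · intro a b hab
    obtain ⟨g, hg, hgl⟩ := exists_affineEval_eq_zero_on_line hab
    set δ := ε * R * (|g 0| + |g 1|) with hδ
    set near := X.filter fun x => |affineEval g x| ≤ δ with hnear
    have hnear2 : near.card ≤ 2 := by
      by_contra hcon
      obtain ⟨x, y, z, hx, hy, hz, hxy, hxz, hyz⟩ := Finset.two_lt_card_iff.1 (not_le.1 hcon)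
      simp only [hnear, Finset.mem_filter] at hx hy hz
      exact h1 x hx.1 y hy.1 z hz.1 hxy hxz hyz g hg ⟨hx.2, hy.2, hz.2⟩
    set I := (Finset.range n).filter fun i => ∃ t ∈ Set.Icc (0 : ℝ) 1, affineEval g (α i t) = 0
      with hI
    set I₁ := (Finset.range n).filter fun i => affineEval g (p i) * affineEval g (p (i + 1)) < 0
      with hI₁
    set I₂ := (Finset.range n).filter fun i => p i ∈ near with hI₂
    set I₃ := (Finset.range n).filter fun i => p (i + 1) ∈ near with hI₃
    have hsub : I ⊆ I₁ ∪ I₂ ∪ I₃ := by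
      intro i hi
      simp only [hI, Finset.mem_filter] at hi
      obtain ⟨hir, t, ht, ht0⟩ := hi
      have hin := Finset.mem_range.1 hir
      simp only [Finset.mem_union, hI₁, hI₂, hI₃, Finset.mem_filter, hir, true_and, hnear,
        hpmem i hin, hpmem' i hin]
      by_cases hs : affineEval g (p i) * affineEval g (p (i + 1)) < 0
      · exact Or.inl (Or.inl hs)
      · rcases near_or_near_of_arc hε.le (hR _ (hpmem i hin) _ (hpmem' i hin)) ht ht0
          (not_lt.1 hs) with h | h
        · exact Or.inl (Or.inr h)
        · exact Or.inr h
    have hI₁c : (I₁.card : ℝ) ≤ 60 * √(n : ℝ) + 1 := by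
      set S := X.filter fun x => 0 < affineEval g x with hS
      have hSd : S ∈ dichotomies X := mem_dichotomies.2
        ⟨Finset.filter_subset _ _, g, fun x hx => by simp [hS, hx]⟩
      refine le_trans ?_ (hcr S hSd)
      rw [Nat.cast_le, hI₁, Finset.card_filter]
      refine Finset.sum_le_sum fun i hi => ?_
      have hin := Finset.mem_range.1 hi
      split_ifs with hs
      · have hm : ¬ (p i ∈ S ↔ p (i + 1) ∈ S) := by
          simp only [hS, Finset.mem_filter, hpmem i hin, hpmem' i hin, true_and]
          rcases mul_neg_iff.1 hs with ⟨u, v⟩ | ⟨u, v⟩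
          · exact fun h => absurd (h.1 u) (not_lt.2 v.le)
          · exact fun h => absurd (h.2 v) (not_lt.2 u.le)
        simp [crossing, hm]
      · exact Nat.zero_le _
    have hI₂c : I₂.card ≤ 2 := by
      refine le_trans (Finset.card_le_card_of_injOn p ?_ ?_) hnear2
      · intro i hi
        exact (Finset.mem_filter.1 hi).2
      · intro i hi j hj h
        exact hpinj i (Finset.mem_range.1 (Finset.mem_filter.1 hi).1) j
          (Finset.mem_range.1 (Finset.mem_filter.1 hj).1) h
    have hI₃c : I₃.card ≤ 2 := by
      refine le_trans (Finset.card_le_card_of_injOn (fun i => p (i + 1)) ?_ ?_) hnear2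
      · intro i hi
        exact (Finset.mem_filter.1 hi).2
      · intro i hi j hj h
        have hi' := Finset.mem_range.1 (Finset.mem_filter.1 hi).1
        have hj' := Finset.mem_range.1 (Finset.mem_filter.1 hj).1
        obtain ⟨k, hk, e, hk'⟩ := hpsucc i hi'
        obtain ⟨l, hl, e', hl'⟩ := hpsucc j hj'
        have := hpinj k hk l hl (by rw [← e, ← e']; exact h)
        omega
    have hIc : (I.card : ℝ) ≤ 60 * √(n : ℝ) + 5 := by
      have h := (Finset.card_le_card hsub).trans ((Finset.card_union_le _ _).trans
        (Nat.add_le_add_right (Finset.card_union_le _ _) _))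
      have h' : I.card ≤ I₁.card + 4 := by omega
      have h'' : (I.card : ℝ) ≤ I₁.card + 4 := by exact_mod_cast h'
      linarith
    have hJ : (⋃ i ∈ Finset.range n, α i '' Set.Icc 0 1) ∩ (line[ℝ, a, b] : Set Plane) ⊆
        ⋃ i ∈ I, α i '' {t | affineEval g (α i t) = 0} := by
      rintro x ⟨hx, hxl⟩
      simp only [Set.mem_iUnion] at hx
      obtain ⟨i, hi, t, ht, rfl⟩ := hx
      have h0 := hgl _ hxl
      exact Set.mem_biUnion (Finset.mem_coe.2 (Finset.mem_filter.2 ⟨hi, t, ht, h0⟩)) ⟨t, h0, rfl⟩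
    have hsum : ∀ I' : Finset ℕ, I' ⊆ Finset.range n →
        (⋃ i ∈ I', α i '' {t | affineEval g (α i t) = 0}).encard ≤ ((2 * I'.card : ℕ) : ℕ∞) := by
      intro I'
      induction I' using Finset.induction_on with
      | empty => simp
      | insert i I' hiI ih =>
        intro hsub'
        rw [Finset.set_biUnion_insert, Finset.card_insert_of_notMem hiI]
        refine (Set.encard_union_le _ _).trans ?_
        have h1 := ih ((Finset.subset_insert _ _).trans hsub')
        have h2 : (α i '' {t | affineEval g (α i t) = 0}).encard ≤ 2 :=
          (Set.encard_image_le _ _).trans (encard_arc_inter_le_two g hg hε.ne'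
            (hedge i (Finset.mem_range.1 (hsub' (Finset.mem_insert_self _ _)))))
        refine (add_le_add h2 h1).trans (le_of_eq ?_)
        push_cast
        ring
    refine (Set.encard_le_encard hJ).trans ((hsum I (Finset.filter_subset _ _)).trans ?_)
    rw [Nat.cast_le]
    apply Nat.le_floor
    have h3n : (3 : ℝ) ≤ n := by exact_mod_cast hX
    have hs1 : 1 ≤ √(n : ℝ) := Real.one_le_sqrt.2 (by linarith)
    push_cast
    linarith

/-- A nonempty set of at most two points can be extended to three points in general position. -/
lemma exists_superset_card_eq_three (X : Finset Plane) (hX : X.Nonempty) (hX2 : X.card ≤ 2) :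
    ∃ X' : Finset Plane, X ⊆ X' ∧ X'.card = 3 ∧ InGeneralPosition X' := by
  classical
  obtain ⟨p, q, hpq, hsub⟩ : ∃ p q : Plane, p ≠ q ∧ X ⊆ {p, q} := by
    have h1 := hX.card_pos
    by_cases h : X.card = 1
    · obtain ⟨p, rfl⟩ := Finset.card_eq_one.1 h
      obtain ⟨q, hq⟩ := exists_ne p
      exact ⟨p, q, hq.symm, by simp⟩
    · obtain ⟨p, q, hpq, rfl⟩ := Finset.card_eq_two.1 (by omega : X.card = 2)
      exact ⟨p, q, hpq, le_rfl⟩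
  set r : Plane := p + rot (q - p) with hr
  have hncol : ¬ Collinear ℝ {p, q, r} := by
    intro hcol
    -- Both `q - p` and its rotation `r - p` would be multiples of one vector `v`, so the squared
    -- length of `q - p`, which is the cross product of the two, would vanish.
    obtain ⟨v, hv⟩ := (collinear_iff_of_mem (p₀ := p) (by simp)).1 hcol
    obtain ⟨s, hs⟩ := hv q (by simp)
    obtain ⟨t, ht⟩ := hv r (by simp)
    have hpos := coord_sub_sq_pos hpq
    have hq0 := congrArg (fun z : Plane => z 0) hs
    have hq1 := congrArg (fun z : Plane => z 1) hs
    have hr0 := congrArg (fun z : Plane => z 0) ht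
    have hr1 := congrArg (fun z : Plane => z 1) ht
    simp only [hr, vadd_eq_add, PiLp.add_apply, PiLp.smul_apply, PiLp.sub_apply, smul_eq_mul,
      rot_zero, rot_one] at hq0 hq1 hr0 hr1
    have e0 : q 0 - p 0 = s * v 0 := by linarith
    have e1 : q 1 - p 1 = s * v 1 := by linarith
    have e2 : -(q 1 - p 1) = t * v 0 := by linarith
    have e3 : q 0 - p 0 = t * v 1 := by linarith
    have : (q 0 - p 0) ^ 2 + (q 1 - p 1) ^ 2 = 0 := by
      linear_combination (q 0 - p 0) * e3 - (q 1 - p 1) * e2 + t * v 1 * e0 - t * v 0 * e1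
    exact hpos.ne' this
  have hpr : p ≠ r := by
    intro h
    rw [← h] at hncol
    exact hncol (by simpa [Set.pair_comm q p, Set.insert_comm] using collinear_pair ℝ p q)
  have hqr : q ≠ r := by
    intro h
    rw [← h] at hncol
    exact hncol (by simpa using collinear_pair ℝ p q)
  refine ⟨{p, q, r}, hsub.trans ?_, Finset.card_eq_three.2 ⟨p, q, r, hpq, hpr, hqr, rfl⟩, ?_⟩
  · intro x hx
    simp only [Finset.mem_insert, Finset.mem_singleton] at hx ⊢
    tauto
  · intro a ha b hb c hc hab hac hbc hcol
    apply hncol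
    simp only [Finset.mem_insert, Finset.mem_singleton] at ha hb hc
    have hset : ({p, q, r} : Set Plane) ⊆ {a, b, c} := by
      intro x hx
      simp only [Set.mem_insert_iff, Set.mem_singleton_iff] at hx ⊢
      grind
    exact hcol.subset hset

theorem lemma4p3 :
    ∃ C : ℝ, 0 < C ∧
      ∀ X : Finset Plane, X.Nonempty → InGeneralPosition X →
        ∃ d : ℕ, (d : ℝ) ≤ C * Real.sqrt (X.card : ℝ) ∧
          degree X ≤ (d : ℕ∞) ∧
          ∃ J : Set Plane, IsJordanCurve J ∧ (X : Set Plane) ⊆ J ∧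
            ∀ p q : Plane, p ≠ q →
              (J ∩ (line[ℝ, p, q] : Set Plane)).encard ≤ (d : ℕ∞) := by
  refine ⟨260, by norm_num, fun X hX hgp => ?_⟩
  obtain ⟨J, hJ, hXJ, d, hd, hline⟩ : ∃ J : Set Plane, IsJordanCurve J ∧ (X : Set Plane) ⊆ J ∧
      ∃ d : ℕ, (d : ℝ) ≤ 260 * √(X.card : ℝ) ∧ ∀ p q : Plane, p ≠ q →
        (J ∩ (line[ℝ, p, q] : Set Plane)).encard ≤ (d : ℕ∞) := by
    rcases le_or_gt 3 X.card with h3 | h3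
    · obtain ⟨J, hJ, hXJ, d, hd, hline⟩ := exists_jordanCurve_of_three_le_card X h3 hgp
      exact ⟨J, hJ, hXJ, d, hd.trans (by gcongr; norm_num), hline⟩
    · obtain ⟨X', hXX', hX', hgp'⟩ := exists_superset_card_eq_three X hX (by omega)
      obtain ⟨J, hJ, hXJ, d, hd, hline⟩ := exists_jordanCurve_of_three_le_card X' hX'.ge hgp'
      refine ⟨J, hJ, fun x hx => hXJ (hXX' hx), d, hd.trans ?_, hline⟩
      -- Here `√3 ≤ 2 ≤ 2 * √(X.card)`.
      have h1 : √((X'.card : ℕ) : ℝ) ≤ 2 := by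
        rw [hX', Real.sqrt_le_left (by norm_num)]
        norm_num
      have h2 : 1 ≤ √(X.card : ℝ) := Real.one_le_sqrt.2 (by exact_mod_cast hX.card_pos)
      linarith
  refine ⟨d, hd, sInf_le ⟨J, ⟨hJ, ?_⟩, hXJ⟩, J, hJ, hXJ, hline⟩
  exact iSup_le fun p => iSup_le fun q => iSup_le fun hpq => iSup_le fun _ => hline p q hpq
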